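/- **Theorem 1.1.** Let $\mathbb T=\{z\in\mathbb C:|z|=1\}$, positively oriented, and for $f$ integrable on $\mathbb T$ let $$[f]_n=f_n=\int_{\mathbb T}z^{-n}f(z)\,\frac{dz}{2\pi i z},\qquad n\in\mathbb Z.$$ For $N>1$ let $D^B_N[\phi;\psi]$ be the determinant of the $N\times N$ matrix with rows and columns numbered $0,\dots,N-1$ whose entry in row $j$ and column $k\le N-2$ is $\phi_{k-j}$, and whose entry in row $j$ of the last column is $\psi_{N-1-j}$. Let $\phi$ be of Szegő type: smooth and nonvanishing on $\mathbb T$, with winding number zero, and with an analytic continuation to a neighborhood of $\mathbb T$. Let $\psi=q_1\phi+q_2$ on $\mathbb T$, where $$q_1(z)=a_0+a_1z+\frac{b_0}{z}+\sum_{j=1}^m\frac{b_jz}{z-c_j},\qquad q_2(z)=\hat a_0+\hat a_1z+\frac{\hat b_0}{z}+\sum_{j=1}^m\frac{\hat b_j}{z-c_j},$$ with $m\ge 0$, all parameters complex, and the $c_j$ nonzero and not on $\mathbb T$. Then $\phi$ has a continuous logarithm $\log\phi$ on $\mathbb T$. For any choice of it, the series below converges absolutely; put $$G[\phi]=\exp\big([\log\phi]_0\big),\qquad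 E[\phi]=\exp\Big(\sum_{n\ge1}n[\log\phi]_n[\log\phi]_{-n}\Big),$$ $$\alpha(z)=\exp\Big(\frac1{2\pi i}\int_{\mathbb T}\frac{\log\phi(\tau)}{\tau-z}\,d\tau\Big)\quad(|z|\ne1),$$ $$F[\phi;\psi]=a_0+b_0[\log\phi]_1+\sum_{0<|c_j|<1}b_j\frac{\alpha(c_j)}{\alpha(0)}+\frac1{\alpha(0)}\Big(\hat a_0-\hat a_1[\log\phi]_{-1}-\sum_{|c_j|>1}\frac{\hat b_j}{c_j}\alpha(c_j)\Big).$$ There is a constant $\mathfrak c>0$, independent of $N$ and of the choice of the logarithm, such that $$D^B_N[\phi;\psi]=G[\phi]^N\,E[\phi]\,\big(F[\phi;\psi]+O(e^{-\mathfrak cN})\big),\qquad N\to\infty.$$ -/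

import Mathlib

open Filter Asymptotics
open scoped Real BigOperators ContDiff

namespace BorderedToeplitz

noncomputable section

/-- The `n`-th Fourier coefficient `∫_𝕋 z⁻ⁿ f(z) dz / (2πiz)` of a function on the unit circle,
`n ∈ ℤ`. Symbols are written as functions `ℂ → ℂ`; only their values on the unit circle are
used. -/
def fourierCoef (f : ℂ → ℂ) (n : ℤ) : ℂ :=
  (2 * π * Complex.I)⁻¹ * ∮ z in C(0, 1), z ^ (-n) * f z / z

/-- The bordered Toeplitz determinant `D^B_N[φ; ψ]`: with rows and columns numbered `0, …, N-1`,
the entry in row `j` and column `k < N-1` is `φ_{k-j}`, and the entry in row `j` of the last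
column is `ψ_{N-1-j}`. -/
def borderedDet (φ ψ : ℂ → ℂ) (N : ℕ) : ℂ :=
  Matrix.det (Matrix.of fun j k : Fin N =>
    if (k : ℕ) + 1 = N then fourierCoef ψ ((N : ℤ) - 1 - (j : ℤ))
    else fourierCoef φ ((k : ℤ) - (j : ℤ)))

/-- The winding number about the origin of the closed curve `t ↦ φ(e^{it})`, `0 ≤ t ≤ 2π`, for a
function `φ` that is smooth and nonvanishing on the unit circle. -/
def windingNumber (φ : ℂ → ℂ) : ℂ :=
  (2 * π * Complex.I)⁻¹ *
    ∫ t in (0 : ℝ)..(2 * π),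
      deriv (fun s : ℝ => φ (circleMap 0 1 s)) t / φ (circleMap 0 1 t)

/-- Symbols of Szegő type: smooth and nonzero on the unit circle, with winding number zero and
with an analytic continuation to a neighbourhood of the unit circle. -/
structure IsSzegoType (φ : ℂ → ℂ) : Prop where
  smooth : ContDiff ℝ ∞ (fun t : ℝ => φ (circleMap 0 1 t))
  ne_zero : ∀ z ∈ Metric.sphere (0 : ℂ) 1, φ z ≠ 0
  winding : windingNumber φ = 0
  continuation : ∃ f : ℂ → ℂ, AnalyticOnNhd ℂ f (Metric.sphere (0 : ℂ) 1) ∧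
    Set.EqOn f φ (Metric.sphere (0 : ℂ) 1)

/-- `L` is a continuous logarithm of `φ` on the unit circle. -/
def IsContinuousLog (φ L : ℂ → ℂ) : Prop :=
  ContinuousOn L (Metric.sphere (0 : ℂ) 1) ∧
    ∀ z ∈ Metric.sphere (0 : ℂ) 1, Complex.exp (L z) = φ z

/-- `G[φ] = exp([log φ]₀)`, where `L = log φ`. -/
def constG (L : ℂ → ℂ) : ℂ := Complex.exp (fourierCoef L 0)

/-- The terms `n [log φ]_n [log φ]_{-n}` of the series in the exponent of `E[φ]`; the term
with `n = 0` is zero. -/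
def termE (L : ℂ → ℂ) (n : ℕ) : ℂ :=
  (n : ℂ) * fourierCoef L (n : ℤ) * fourierCoef L (-(n : ℤ))

/-- `E[φ] = exp(∑_{n ≥ 1} n [log φ]_n [log φ]_{-n})`, where `L = log φ`. -/
def constE (L : ℂ → ℂ) : ℂ := Complex.exp (∑' n : ℕ, termE L n)

/-- The Szegő function `α(z) = exp((1/2πi) ∫_𝕋 log φ(τ) / (τ - z) dτ)`, `|z| ≠ 1`, where
`L = log φ`. -/
def szegoFun (L : ℂ → ℂ) (z : ℂ) : ℂ :=
  Complex.exp ((2 * π * Complex.I)⁻¹ * ∮ τ in C(0, 1), L τ / (τ - z))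

/-- `q₁(z) = a₀ + a₁ z + b₀ / z + ∑ⱼ bⱼ z / (z - cⱼ)`. -/
def ratq₁ {m : ℕ} (a₀ a₁ b₀ : ℂ) (b c : Fin m → ℂ) (z : ℂ) : ℂ :=
  a₀ + a₁ * z + b₀ / z + ∑ j, b j * z / (z - c j)

/-- `q₂(z) = â₀ + â₁ z + b̂₀ / z + ∑ⱼ b̂ⱼ / (z - cⱼ)`. -/
def ratq₂ {m : ℕ} (ah₀ ah₁ bh₀ : ℂ) (bh c : Fin m → ℂ) (z : ℂ) : ℂ :=
  ah₀ + ah₁ * z + bh₀ / z + ∑ j, bh j / (z - c j)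

open Classical in
/-- The constant `F[φ; ψ]`, where `L = log φ`. -/
def constF {m : ℕ} (L : ℂ → ℂ) (a₀ b₀ ah₀ ah₁ : ℂ) (b bh c : Fin m → ℂ) : ℂ :=
  a₀ + b₀ * fourierCoef L 1
    + ∑ j with 0 < ‖c j‖ ∧ ‖c j‖ < 1, b j * (szegoFun L (c j) / szegoFun L 0)
    + 1 / szegoFun L 0 *
      (ah₀ - ah₁ * fourierCoef L (-1)
        - ∑ j with 1 < ‖c j‖, bh j / c j * szegoFun L (c j))

end

end BorderedToeplitz

open Metric MeasureTheory

namespace BorderedToeplitz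

/-! ### Fourier coefficients of functions on the unit circle -/

/-! On the circle write log φ = l + g(z) + k(1/z), with g and k analytic in a disc of radius greater
than 1 and zero at the origin (`exists_logParts`). Then G = e^l and φ = G e^{g(z)} e^{k(1/z)}.
Reversing rows and columns turns the bordered determinant into G^N times the determinant of the
Toeplitz matrix T_N of e^{g(z)} e^{k(1/z)} with its first column replaced by coefficients of ψ/G
(`borderedDet_eq_cramer`). By Cramer's rule this is formally det T_N times the component of index 0
of a solution. The form of ψ gives ψ/G = e^{k(1/z)} χ with χ = q₁ e^g + e^{-l} q₂ e^{-k(1/z)}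
analytic near the circle. Wiener–Hopf factorization solves the semi-infinite system explicitly
(`exists_toeplitz_solution`); the component of index 0 is χ_0, and residues identify χ_0 with F
(`fourierCoef_borderSymbol`).

The passage to finite N uses adjugates, so invertibility of T_N is never needed. The solution decays
exponentially, so its truncation error is exponentially small, and it is multiplied by the adjugate
of T_N, whose entries are O(N²) (`exists_norm_adjugate_toep_le`): unimodular triangular Toeplitz
factors reduce T_N to a matrix whose row sums have a product bounded in N.

That det T_N tends to E is proved by deforming k to tk, 0 ≤ t ≤ 1. The derivative of the determinant
is a sum of Cramer determinants, evaluated by the same truncation argument; it equals S det +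
O(ρ^N), where S = ∑ n [log φ]_n [log φ]_{-n} does not depend on t (`exists_norm_trace_sub_le`).
Integrating from determinant 1 at t = 0 gives e^S (`exists_norm_det_sub_le`). -/

theorem circleMap_mem_unitSphere (t : ℝ) : circleMap 0 1 t ∈ sphere (0 : ℂ) 1 :=
  circleMap_mem_sphere _ zero_le_one _

theorem circleMap_one_ne_zero (t : ℝ) : circleMap 0 1 t ≠ 0 :=
  circleMap_ne_center one_ne_zero

theorem ne_zero_of_mem_unitSphere {z : ℂ} (hz : z ∈ sphere (0 : ℂ) 1) : z ≠ 0 := by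
  rintro rfl
  simp at hz

theorem inv_mem_unitSphere {z : ℂ} (hz : z ∈ sphere (0 : ℂ) 1) : z⁻¹ ∈ sphere (0 : ℂ) 1 := by
  simp_all

theorem continuous_comp_circleMap {f : ℂ → ℂ} (hf : ContinuousOn f (sphere 0 1)) :
    Continuous fun t : ℝ => f (circleMap 0 1 t) :=
  hf.comp_continuous (continuous_circleMap 0 1) circleMap_mem_unitSphere

theorem continuousOn_zpow_unitSphere (n : ℤ) :
    ContinuousOn (fun z : ℂ => z ^ n) (sphere 0 1) := fun _ hz =>
  (continuousAt_zpow₀ _ n (Or.inl (ne_zero_of_mem_unitSphere hz))).continuousWithinAt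

theorem fourierCoef_eq_integral (f : ℂ → ℂ) (n : ℤ) :
    fourierCoef f n =
      (2 * π : ℂ)⁻¹ * ∫ t in (0 : ℝ)..(2 * π), circleMap 0 1 t ^ (-n) * f (circleMap 0 1 t) := by
  have h : (∮ z in C(0, 1), z ^ (-n) * f z / z) =
      Complex.I * ∫ t in (0 : ℝ)..(2 * π), circleMap 0 1 t ^ (-n) * f (circleMap 0 1 t) := by
    rw [circleIntegral, ← intervalIntegral.integral_const_mul]
    refine intervalIntegral.integral_congr fun t _ => ?_
    have := circleMap_one_ne_zero t
    simp only [deriv_circleMap, smul_eq_mul]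
    field_simp
  rw [fourierCoef, h, mul_inv, mul_assoc, inv_mul_cancel_left₀ Complex.I_ne_zero]

theorem fourierCoef_congr {f g : ℂ → ℂ} (h : Set.EqOn f g (sphere 0 1)) (n : ℤ) :
    fourierCoef f n = fourierCoef g n := by
  simp only [fourierCoef_eq_integral, h (circleMap_mem_unitSphere _)]

theorem continuous_fourier_integrand {f : ℂ → ℂ} (hf : ContinuousOn f (sphere 0 1)) (n : ℤ) :
    Continuous fun t : ℝ => circleMap 0 1 t ^ n * f (circleMap 0 1 t) :=
  (continuous_comp_circleMap (continuousOn_zpow_unitSphere n)).mul (continuous_comp_circleMap hf)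

theorem fourierCoef_const_mul (a : ℂ) (f : ℂ → ℂ) (n : ℤ) :
    fourierCoef (fun z => a * f z) n = a * fourierCoef f n := by
  simp only [fourierCoef_eq_integral, mul_left_comm _ a, intervalIntegral.integral_const_mul]

theorem fourierCoef_add {f g : ℂ → ℂ} (hf : ContinuousOn f (sphere 0 1))
    (hg : ContinuousOn g (sphere 0 1)) (n : ℤ) :
    fourierCoef (fun z => f z + g z) n = fourierCoef f n + fourierCoef g n := by
  simp only [fourierCoef_eq_integral, mul_add]
  rw [intervalIntegral.integral_add, mul_add]
  · exact (continuous_fourier_integrand hf _).intervalIntegrable _ _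
  · exact (continuous_fourier_integrand hg _).intervalIntegrable _ _

theorem fourierCoef_sub {f g : ℂ → ℂ} (hf : ContinuousOn f (sphere 0 1))
    (hg : ContinuousOn g (sphere 0 1)) (n : ℤ) :
    fourierCoef (fun z => f z - g z) n = fourierCoef f n - fourierCoef g n := by
  have h := fourierCoef_add hf (continuousOn_const.mul hg : ContinuousOn (fun z => -1 * g z) _) n
  change fourierCoef (fun z => f z + -1 * g z) n = _ + fourierCoef (fun z => -1 * g z) n at h
  rw [fourierCoef_const_mul] at h
  simpa only [neg_one_mul, ← sub_eq_add_neg] using h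

theorem fourierCoef_finset_sum {ι : Type*} (s : Finset ι) {f : ι → ℂ → ℂ}
    (hf : ∀ i ∈ s, ContinuousOn (f i) (sphere 0 1)) (n : ℤ) :
    fourierCoef (fun z => ∑ i ∈ s, f i z) n = ∑ i ∈ s, fourierCoef (f i) n := by
  simp only [fourierCoef_eq_integral, Finset.mul_sum]
  rw [intervalIntegral.integral_finsetSum, Finset.mul_sum]
  exact fun i hi => (continuous_fourier_integrand (hf i hi) _).intervalIntegrable _ _

theorem fourierCoef_zpow_mul (f : ℂ → ℂ) (k n : ℤ) :
    fourierCoef (fun z => z ^ k * f z) n = fourierCoef f (n - k) := by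
  simp only [fourierCoef_eq_integral, ← mul_assoc, ← zpow_add₀ (circleMap_one_ne_zero _)]
  rw [show -(n - k) = -n + k by ring]

/-- Inversion on the circle is t ↦ -t; periodicity moves [-2π, 0] back to [0, 2π]. -/
theorem fourierCoef_comp_inv (f : ℂ → ℂ) (n : ℤ) :
    fourierCoef (fun z => f z⁻¹) n = fourierCoef f (-n) := by
  simp only [fourierCoef_eq_integral]
  congr 1
  have hper : Function.Periodic
      (fun t : ℝ => circleMap 0 1 t ^ (- -n) * f (circleMap 0 1 t)) (2 * π) := fun t => by
    simp only [periodic_circleMap 0 1 t]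
  have h2 := intervalIntegral.integral_comp_neg (a := 0) (b := 2 * π)
    (fun t : ℝ => circleMap 0 1 t ^ (- -n) * f (circleMap 0 1 t))
  have h3 := hper.intervalIntegral_add_eq (-(2 * π)) 0
  rw [neg_add_cancel, zero_add] at h3
  rw [neg_zero, h3] at h2
  rw [← h2]
  refine intervalIntegral.integral_congr fun t _ => ?_
  have h4 : (circleMap 0 1 t)⁻¹ = circleMap 0 1 (-t) := by rw [circleMap_zero_inv, inv_one]
  simp only [← h4, inv_zpow', neg_neg]

theorem exists_norm_le_unitSphere {f : ℂ → ℂ} (hf : ContinuousOn f (sphere 0 1)) :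
    ∃ M, 0 ≤ M ∧ ∀ z ∈ sphere (0 : ℂ) 1, ‖f z‖ ≤ M := by
  obtain ⟨M, hM⟩ := (isCompact_sphere (0 : ℂ) 1).exists_bound_of_continuousOn hf
  exact ⟨M, (norm_nonneg _).trans (hM 1 (by simp)), hM⟩

/-- Termwise integration under the bound ‖u k‖ M. The coefficients `u` are not assumed to be those
of `f`: the case g = 1 proves that they are, in `fourierCoef_of_hasSum`. -/
theorem hasSum_fourierCoef_mul {u : ℤ → ℂ} (hu : Summable fun n => ‖u n‖) {f g : ℂ → ℂ}
    (hf : ∀ z ∈ sphere (0 : ℂ) 1, HasSum (fun k => u k * z ^ k) (f z))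
    (hg : ContinuousOn g (sphere 0 1)) (n : ℤ) :
    HasSum (fun k => u k * fourierCoef g (n - k)) (fourierCoef (fun z => f z * g z) n) := by
  obtain ⟨M, hM0, hM⟩ := exists_norm_le_unitSphere hg
  have key := intervalIntegral.hasSum_integral_of_dominated_convergence (μ := volume)
    (a := 0) (b := 2 * π)
    (F := fun k (t : ℝ) => u k * (circleMap 0 1 t ^ (-(n - k)) * g (circleMap 0 1 t)))
    (f := fun t : ℝ => circleMap 0 1 t ^ (-n) * (f (circleMap 0 1 t) * g (circleMap 0 1 t)))
    (fun k _ => ‖u k‖ * M)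
    (fun k => ((continuous_fourier_integrand hg _).const_mul _).aestronglyMeasurable)
    (fun k => ae_of_all _ fun t _ => by
      rw [norm_mul, norm_mul, norm_zpow, norm_circleMap_zero, abs_one, one_zpow, one_mul]
      gcongr
      exact hM _ (circleMap_mem_unitSphere t))
    (ae_of_all _ fun t _ => hu.mul_right _)
    intervalIntegrable_const
    (ae_of_all _ fun t _ => by
      have h := ((hf _ (circleMap_mem_unitSphere t)).mul_left (circleMap 0 1 t ^ (-n))).mul_right
        (g (circleMap 0 1 t))
      rw [mul_assoc] at h
      refine (congrArg (HasSum · _) (funext fun k => ?_)).mpr h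
      rw [neg_sub, zpow_sub₀ (circleMap_one_ne_zero t), zpow_neg]
      field_simp)
  simp only [intervalIntegral.integral_const_mul] at key
  simp only [fourierCoef_eq_integral]
  refine (congrArg (HasSum · _) (funext fun k => ?_)).mpr (key.mul_left (2 * π : ℂ)⁻¹)
  rw [mul_left_comm]

/-! ### Absolutely convergent Fourier series -/

/-- Functions on the unit circle with an absolutely convergent Fourier series. -/
structure IsWiener (f : ℂ → ℂ) : Prop where
  continuousOn : ContinuousOn f (sphere 0 1)
  summable : Summable fun n => ‖fourierCoef f n‖

theorem IsWiener.hasSum {f : ℂ → ℂ} (hf : IsWiener f) {z : ℂ} (hz : z ∈ sphere (0 : ℂ) 1) :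
    HasSum (fun k => fourierCoef f k * z ^ k) (f z) := by
  have : Fact (0 < 2 * π) := ⟨Real.two_pi_pos⟩
  let F : C(AddCircle (2 * π), ℂ) :=
    ⟨fun x => f (AddCircle.toCircle x), hf.continuousOn.comp_continuous
      (continuous_subtype_val.comp AddCircle.continuous_toCircle) fun x => by
        rw [mem_sphere_zero_iff_norm]
        exact Circle.norm_coe _⟩
  have hcoe : ∀ t : ℝ, ((AddCircle.toCircle (t : AddCircle (2 * π)) : Circle) : ℂ) =
      circleMap 0 1 t := fun t => by
    rw [AddCircle.toCircle_apply_mk, Circle.coe_exp, circleMap_zero]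
    rw [div_self Real.two_pi_pos.ne', one_mul, Complex.ofReal_one, one_mul]
  have hc : ∀ n : ℤ, fourierCoeff F n = fourierCoef f n := fun n => by
    rw [fourierCoeff_eq_intervalIntegral _ _ 0, fourierCoef_eq_integral, zero_add,
      Complex.real_smul]
    congr 1
    · push_cast
      rw [one_div]
    · refine intervalIntegral.integral_congr fun t _ => ?_
      simp only [fourier_apply, AddCircle.toCircle_zsmul, smul_eq_mul, Circle.coe_zpow, hcoe]
      simp [F, hcoe]
  have hs : Summable (fourierCoeff F) := by
    rw [funext hc]
    exact hf.summable.of_norm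
  obtain ⟨t, rfl⟩ : ∃ t : ℝ, circleMap 0 1 t = z := by
    have : z ∈ Set.range (circleMap 0 1) := by rw [range_circleMap]; simpa using hz
    exact this
  have h := has_pointwise_sum_fourier_series_of_summable hs (t : AddCircle (2 * π))
  simp only [hc, fourier_apply, AddCircle.toCircle_zsmul, smul_eq_mul, Circle.coe_zpow, hcoe] at h
  simpa [F, hcoe] using h

theorem IsWiener.hasSum_mul {f g : ℂ → ℂ} (hf : IsWiener f) (hg : ContinuousOn g (sphere 0 1))
    (n : ℤ) :
    HasSum (fun k => fourierCoef f k * fourierCoef g (n - k))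
      (fourierCoef (fun z => f z * g z) n) :=
  hasSum_fourierCoef_mul hf.summable (fun _ hz => hf.hasSum hz) hg n

theorem fourierCoef_one (n : ℤ) : fourierCoef (fun _ => 1) n = if n = 0 then 1 else 0 := by
  have h : ∀ n : ℤ, fourierCoef (fun _ => 1) n =
      (2 * π * Complex.I)⁻¹ * ∮ z in C(0, 1), (z - 0) ^ (-n - 1) := fun n => by
    rw [fourierCoef]
    congr 1
    refine circleIntegral.integral_congr zero_le_one fun z hz => ?_
    have := ne_zero_of_mem_unitSphere hz
    simp only [mul_one, sub_zero]
    rw [zpow_sub_one₀ this, div_eq_mul_inv]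
  rw [h]
  split_ifs with h0
  · subst h0
    have : ∀ z : ℂ, (z - 0) ^ (-(0 : ℤ) - 1) = (z - 0)⁻¹ := fun z => by simp
    simp only [this]
    rw [circleIntegral.integral_sub_center_inv _ one_ne_zero]
    exact inv_mul_cancel₀ (by simp [Real.pi_ne_zero])
  · rw [circleIntegral.integral_sub_zpow_of_ne (by omega), mul_zero]

theorem fourierCoef_of_hasSum {u : ℤ → ℂ} (hu : Summable fun n => ‖u n‖) {f : ℂ → ℂ}
    (hf : ∀ z ∈ sphere (0 : ℂ) 1, HasSum (fun k => u k * z ^ k) (f z)) (n : ℤ) :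
    fourierCoef f n = u n := by
  have h := hasSum_fourierCoef_mul hu hf (g := fun _ => 1) continuousOn_const n
  simp only [mul_one, fourierCoef_one] at h
  refine h.unique ?_
  convert hasSum_single n fun k hk => ?_ using 1
  · simp
  · rw [if_neg (by omega), mul_zero]

theorem exists_isWiener_of_summable {u : ℤ → ℂ} (hu : Summable fun n => ‖u n‖) :
    ∃ f, IsWiener f ∧ ∀ n, fourierCoef f n = u n := by
  have hnorm : ∀ z ∈ sphere (0 : ℂ) 1, ∀ k : ℤ, ‖u k * z ^ k‖ = ‖u k‖ := fun z hz k => by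
    rw [norm_mul, norm_zpow, mem_sphere_zero_iff_norm.1 hz, one_zpow, mul_one]
  have hs : ∀ z ∈ sphere (0 : ℂ) 1, HasSum (fun k => u k * z ^ k) (∑' k, u k * z ^ k) :=
    fun z hz => (Summable.of_norm (by simpa only [hnorm z hz] using hu)).hasSum
  have hc := fourierCoef_of_hasSum hu hs
  refine ⟨fun z => ∑' k, u k * z ^ k, ⟨?_, ?_⟩, hc⟩
  · exact continuousOn_tsum (fun k => continuousOn_const.mul (continuousOn_zpow_unitSphere k)) hu
      fun k z hz => (hnorm z hz k).le
  · simpa only [hc] using hu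

theorem exists_nonneg_projection {f : ℂ → ℂ} (hf : IsWiener f) :
    ∃ w, IsWiener w ∧ ∀ n, fourierCoef w n = if 0 ≤ n then fourierCoef f n else 0 := by
  refine exists_isWiener_of_summable (hf.summable.of_nonneg_of_le (fun n => norm_nonneg _) ?_)
  intro n
  split_ifs <;> simp

theorem summable_pow_natAbs {ρ : ℝ} (h0 : 0 ≤ ρ) (h1 : ρ < 1) :
    Summable fun n : ℤ => ρ ^ n.natAbs := by
  refine Summable.of_nat_of_neg ?_ ?_ <;> simpa using summable_geometric_of_lt_one h0 h1

theorem IsWiener.of_decay {f : ℂ → ℂ} (hf : ContinuousOn f (sphere 0 1)) {C ρ : ℝ} (h0 : 0 ≤ ρ)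
    (h1 : ρ < 1) (h : ∀ n, ‖fourierCoef f n‖ ≤ C * ρ ^ n.natAbs) : IsWiener f :=
  ⟨hf, ((summable_pow_natAbs h0 h1).mul_left C).of_nonneg_of_le (fun _ => norm_nonneg _) h⟩

/-- Integration by parts: the derivative of z^{-n} f integrates to zero over a period. Here `f'` is
the angular derivative divided by i. -/
theorem fourierCoef_deriv {f f' : ℂ → ℂ} (hf' : ContinuousOn f' (sphere 0 1))
    (hf : ∀ t : ℝ, HasDerivAt (fun t : ℝ => f (circleMap 0 1 t))
      (Complex.I * f' (circleMap 0 1 t)) t) (n : ℤ) :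
    fourierCoef f' n = n * fourierCoef f n := by
  have hcirc : ∀ t : ℝ, HasDerivAt (fun t : ℝ => circleMap 0 1 t ^ (-n))
      (-n * Complex.I * circleMap 0 1 t ^ (-n)) t := fun t => by
    have h := (hasDerivAt_zpow (-n) _ (Or.inl (circleMap_one_ne_zero t))).comp t
      (hasDerivAt_circleMap 0 1 t)
    refine h.congr_deriv ?_
    rw [zpow_sub_one₀ (circleMap_one_ne_zero t)]
    have := circleMap_one_ne_zero t
    push_cast
    field_simp
  have hfc : Continuous fun t : ℝ => f (circleMap 0 1 t) :=
    continuous_iff_continuousAt.2 fun t => (hf t).continuousAt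
  have hzc := continuous_comp_circleMap (continuousOn_zpow_unitSphere (-n))
  have h1c : Continuous fun t : ℝ => -n * Complex.I * circleMap 0 1 t ^ (-n) * f (circleMap 0 1 t) :=
    (continuous_const.mul hzc).mul hfc
  have h2c : Continuous fun t : ℝ => circleMap 0 1 t ^ (-n) * (Complex.I * f' (circleMap 0 1 t)) :=
    hzc.mul (continuous_const.mul (continuous_comp_circleMap hf'))
  have key := intervalIntegral.integral_eq_sub_of_hasDerivAt (a := 0) (b := 2 * π)
    (fun t _ => (hcirc t).mul (hf t)) ((h1c.add h2c).intervalIntegrable _ _)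
  rw [intervalIntegral.integral_add (h1c.intervalIntegrable _ _) (h2c.intervalIntegrable _ _)]
    at key
  have hper : circleMap 0 1 (2 * π) = circleMap 0 1 0 := by
    simpa using periodic_circleMap 0 1 0
  simp only [Pi.mul_apply, hper, sub_self, mul_assoc, mul_left_comm _ Complex.I,
    intervalIntegral.integral_const_mul, ← mul_add, mul_eq_zero, Complex.I_ne_zero, false_or] at key
  rw [fourierCoef_eq_integral, fourierCoef_eq_integral]
  linear_combination (2 * π : ℂ)⁻¹ * key

/-! ### Functions that are analytic near the circle or in a disc -/

/-- Move the contour to radius R for n ≥ 0 and to radius 1/R for n ≤ 0; there |z^{-n}| = R^{-|n|}.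
-/
theorem norm_fourierCoef_le_of_annulus {f : ℂ → ℂ} {R M : ℝ} (hR : 1 < R)
    (hf : ∀ z : ℂ, R⁻¹ ≤ ‖z‖ → ‖z‖ ≤ R → DifferentiableAt ℂ f z)
    (hM : ∀ z : ℂ, R⁻¹ ≤ ‖z‖ → ‖z‖ ≤ R → ‖f z‖ ≤ M) (n : ℤ) :
    ‖fourierCoef f n‖ ≤ M * R⁻¹ ^ n.natAbs := by
  have hR0 : 0 < R := one_pos.trans hR
  have hRi : R⁻¹ < 1 := inv_lt_one_of_one_lt₀ hR
  have hd : ∀ z : ℂ, R⁻¹ ≤ ‖z‖ → ‖z‖ ≤ R → DifferentiableAt ℂ (fun z => z ^ (-n) * f z) z :=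
    fun z h1 h2 => (differentiableAt_zpow.2 (Or.inl (norm_pos_iff.1
      ((inv_pos.2 hR0).trans_le h1)))).mul (hf z h1 h2)
  have hmove : ∀ r₁ r₂ : ℝ, R⁻¹ ≤ r₁ → r₁ ≤ r₂ → r₂ ≤ R →
      (∮ z in C(0, r₂), (z - 0)⁻¹ • (z ^ (-n) * f z)) =
        ∮ z in C(0, r₁), (z - 0)⁻¹ • (z ^ (-n) * f z) := fun r₁ r₂ h1 h12 h2 => by
    refine Complex.circleIntegral_sub_center_inv_smul_eq_of_differentiable_on_annulus_off_countable
      ((inv_pos.2 hR0).trans_le h1) h12 Set.countable_empty (fun z hz => ?_) fun z hz => ?_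
    · simp only [Set.mem_sdiff, mem_closedBall, dist_zero_right, mem_ball, not_lt] at hz
      exact (hd z (h1.trans hz.2) (hz.1.trans h2)).continuousAt.continuousWithinAt
    · simp only [Set.sdiff_empty, Set.mem_sdiff, mem_closedBall, dist_zero_right, mem_ball,
        not_le] at hz
      exact hd z (h1.trans hz.2.le) (hz.1.le.trans h2)
  have hone : fourierCoef f n =
      (2 * π * Complex.I)⁻¹ • ∮ z in C(0, 1), (z - 0)⁻¹ • (z ^ (-n) * f z) := by
    simp only [fourierCoef, sub_zero, smul_eq_mul, div_eq_inv_mul]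
  have hbound : ∀ r : ℝ, R⁻¹ ≤ r → r ≤ R →
      ‖(2 * π * Complex.I)⁻¹ • ∮ z in C(0, r), (z - 0)⁻¹ • (z ^ (-n) * f z)‖ ≤
        r ^ (-n) * M := fun r h1 h2 => by
    have hr := (inv_pos.2 hR0).trans_le h1
    refine (circleIntegral.norm_two_pi_i_inv_smul_integral_le_of_norm_le_const
      (C := r⁻¹ * (r ^ (-n) * M)) hr.le fun z hz => ?_).trans_eq ?_
    · have hz' := mem_sphere_zero_iff_norm.1 hz
      rw [sub_zero, norm_smul, norm_mul, norm_inv, norm_zpow, hz']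
      gcongr
      exact hM z (by rwa [hz']) (by rwa [hz'])
    · rw [← mul_assoc, mul_inv_cancel₀ hr.ne', one_mul]
  obtain ⟨m, rfl | rfl⟩ := n.eq_nat_or_neg
  · rw [hone, ← hmove 1 R hRi.le hR.le le_rfl]
    refine (hbound R (hRi.le.trans hR.le) le_rfl).trans_eq ?_
    rw [zpow_neg, zpow_natCast, Int.natAbs_natCast, inv_pow, mul_comm]
  · rw [hone, hmove R⁻¹ 1 le_rfl hRi.le hR.le]
    refine (hbound R⁻¹ le_rfl (hRi.le.trans hR.le)).trans_eq ?_
    rw [neg_neg, zpow_natCast, Int.natAbs_neg, Int.natAbs_natCast, mul_comm]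

section Disc

variable {f : ℂ → ℂ} {R : ℝ}

theorem closedBall_one_subset (hR : 1 < R) : closedBall (0 : ℂ) 1 ⊆ ball 0 R :=
  closedBall_subset_ball hR

theorem continuousOn_unitSphere_of_disc (hR : 1 < R) (hf : DifferentiableOn ℂ f (ball 0 R)) :
    ContinuousOn f (sphere 0 1) :=
  hf.continuousOn.mono (sphere_subset_closedBall.trans (closedBall_one_subset hR))

theorem fourierCoef_of_neg (hR : 1 < R) (hf : DifferentiableOn ℂ f (ball 0 R)) {n : ℤ}
    (hn : n < 0) : fourierCoef f n = 0 := by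
  have h : ∀ z ∈ sphere (0 : ℂ) 1, z ^ (-n) * f z / z = z ^ (-n - 1).toNat * f z := fun z hz => by
    rw [← zpow_natCast, Int.toNat_of_nonneg (by omega), zpow_sub_one₀ (ne_zero_of_mem_unitSphere hz)]
    ring
  have hd : DifferentiableOn ℂ (fun z => z ^ (-n - 1).toNat * f z) (ball 0 R) :=
    (differentiableOn_id.pow _).mul hf
  rw [fourierCoef, circleIntegral.integral_congr zero_le_one h,
    (hd.mono (closedBall_one_subset hR)).diffContOnCl_ball subset_rfl |>.circleIntegral_eq_zero
      zero_le_one, mul_zero]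

/-- The numerator z cancels the 1/z of the measure, which leaves Cauchy's formula at c. -/
theorem fourierCoef_div_sub_mul (hR : 1 < R) (hf : DifferentiableOn ℂ f (ball 0 R)) {c : ℂ}
    (hc : ‖c‖ < 1) : fourierCoef (fun z => z / (z - c) * f z) 0 = f c := by
  have h : ∀ z ∈ sphere (0 : ℂ) 1, z ^ (-0 : ℤ) * (z / (z - c) * f z) / z =
      (z - c)⁻¹ • f z := fun z hz => by
    have := ne_zero_of_mem_unitSphere hz
    rw [neg_zero, zpow_zero, smul_eq_mul, one_mul]
    field_simp
  rw [fourierCoef, circleIntegral.integral_congr zero_le_one h]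
  exact (((hf.mono (closedBall_one_subset hR)).diffContOnCl_ball
    subset_rfl).two_pi_i_inv_smul_circleIntegral_sub_inv_smul (by simpa using hc))

theorem fourierCoef_div_sub_mul_of_one_lt (hR : 1 < R) (hf : DifferentiableOn ℂ f (ball 0 R))
    {c : ℂ} (hc : 1 < ‖c‖) : fourierCoef (fun z => z / (z - c) * f z) 0 = 0 := by
  have h : ∀ z ∈ sphere (0 : ℂ) 1, z ^ (-0 : ℤ) * (z / (z - c) * f z) / z =
      (z - c)⁻¹ * f z := fun z hz => by
    have := ne_zero_of_mem_unitSphere hz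
    rw [neg_zero, zpow_zero, one_mul]
    field_simp
  have hd : DifferentiableOn ℂ (fun z => (z - c)⁻¹ * f z) (closedBall 0 1) := by
    refine DifferentiableOn.mul (DifferentiableOn.inv (by fun_prop) fun z hz => ?_)
      (hf.mono (closedBall_one_subset hR))
    rintro h0
    rw [sub_eq_zero.1 h0, mem_closedBall_zero_iff] at hz
    exact hz.not_gt hc
  rw [fourierCoef, circleIntegral.integral_congr zero_le_one h,
    (hd.diffContOnCl_ball subset_rfl).circleIntegral_eq_zero zero_le_one, mul_zero]

theorem fourierCoef_zero_of_disc (hR : 1 < R) (hf : DifferentiableOn ℂ f (ball 0 R)) :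
    fourierCoef f 0 = f 0 := by
  rw [← fourierCoef_div_sub_mul hR hf (c := 0) (by simp)]
  refine fourierCoef_congr (fun z hz => ?_) 0
  have := ne_zero_of_mem_unitSphere hz
  simp only [sub_zero, div_self this, one_mul]

theorem fourierCoef_mul_deriv {f : ℂ → ℂ}
    (hf : ∀ z ∈ sphere (0 : ℂ) 1, DifferentiableAt ℂ f z)
    (hc : ContinuousOn (fun z => z * deriv f z) (sphere 0 1)) (n : ℤ) :
    fourierCoef (fun z => z * deriv f z) n = n * fourierCoef f n := by
  refine fourierCoef_deriv hc (fun t => ?_) n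
  refine ((hf _ (circleMap_mem_unitSphere t)).hasDerivAt.comp t
    (hasDerivAt_circleMap 0 1 t)).congr_deriv ?_
  ring

theorem fourierCoef_one_of_disc (hR : 1 < R) (hf : DifferentiableOn ℂ f (ball 0 R)) :
    fourierCoef f 1 = deriv f 0 := by
  have hd := hf.deriv isOpen_ball
  have h := fourierCoef_mul_deriv (f := f)
    (fun z hz => hf.differentiableAt (isOpen_ball.mem_nhds
      (closedBall_one_subset hR (sphere_subset_closedBall hz))))
    (continuousOn_id.mul (continuousOn_unitSphere_of_disc hR hd)) 1
  rw [Int.cast_one, one_mul] at h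
  rw [← h, ← fourierCoef_zero_of_disc hR hd]
  simpa using fourierCoef_zpow_mul (deriv f) 1 1

end Disc

/-! ### Bounds for determinants and adjugates -/

section Determinants

variable {n : Type*} [Fintype n] [DecidableEq n]

/-- Expanding the product of the row sums gives one nonnegative term for every map n → n, and the
permutations are among these. -/
theorem norm_det_le_prod_row_sum (A : Matrix n n ℂ) : ‖A.det‖ ≤ ∏ i, ∑ j, ‖A i j‖ := by
  rw [← Matrix.det_transpose, Matrix.det_apply']
  calc ‖∑ σ : Equiv.Perm n, ((Equiv.Perm.sign σ : ℤ) : ℂ) * ∏ i, A.transpose (σ i) i‖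
      ≤ ∑ σ : Equiv.Perm n, ∏ i, ‖A i (σ i)‖ := by
        refine norm_sum_le_of_le _ fun σ _ => ?_
        rw [norm_mul, norm_prod]
        rcases Int.units_eq_one_or (Equiv.Perm.sign σ) with h | h <;>
          simp [h, Matrix.transpose_apply]
    _ ≤ ∑ f : n → n, ∏ i, ‖A i (f i)‖ := by
        rw [← Finset.sum_image (s := Finset.univ) (g := fun σ : Equiv.Perm n => (σ : n → n))
          (f := fun f : n → n => ∏ i, ‖A i (f i)‖) fun _ _ _ _ h => Equiv.coe_fn_injective h]
        exact Finset.sum_le_sum_of_subset_of_nonneg (Finset.subset_univ _)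
          fun _ _ _ => Finset.prod_nonneg fun _ _ => norm_nonneg _
    _ = ∏ i, ∑ j, ‖A i j‖ := by
        rw [Finset.prod_univ_sum, Fintype.piFinset_univ]

theorem norm_det_le_of_row_sum_le {A : Matrix n n ℂ} {b : n → ℝ}
    (h : ∀ i, ∑ j, ‖A i j‖ ≤ b i) : ‖A.det‖ ≤ ∏ i, b i :=
  (norm_det_le_prod_row_sum A).trans <| Finset.prod_le_prod
    (fun _ _ => Finset.sum_nonneg fun _ _ => norm_nonneg _) fun i _ => h i

/-- An entry of the adjugate is a determinant with one row replaced by a unit vector. That row has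
sum 1, whence the condition 1 ≤ b i. -/
theorem norm_adjugate_le_of_row_sum_le {A : Matrix n n ℂ} {b : n → ℝ} (hb : ∀ i, 1 ≤ b i)
    (h : ∀ i, ∑ j, ‖A i j‖ ≤ b i) (i j : n) : ‖A.adjugate i j‖ ≤ ∏ i, b i := by
  rw [Matrix.adjugate_apply]
  refine norm_det_le_of_row_sum_le fun k => ?_
  rcases eq_or_ne k j with rfl | hk
  · refine le_trans (le_of_eq ?_) (hb k)
    rw [Finset.sum_eq_single i] <;> simp +contextual
  · simpa [Matrix.updateRow_ne hk] using h k

/-- Apply the adjugate to the residual v - A x. No inverse occurs, so `A` may be singular. -/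
theorem norm_cramer_sub_le {A : Matrix n n ℂ} {x v : n → ℂ} {B ε : ℝ}
    (hB : ∀ i j, ‖A.adjugate i j‖ ≤ B) (h : ∀ i, ‖v i - A.mulVec x i‖ ≤ ε) (k : n) :
    ‖A.cramer v k - A.det * x k‖ ≤ Fintype.card n * (B * ε) := by
  have h1 : A.adjugate.mulVec (A.mulVec x) = A.det • x := by
    rw [Matrix.mulVec_mulVec, Matrix.adjugate_mul, Matrix.smul_mulVec, Matrix.one_mulVec]
  have h2 : A.cramer v k - A.det * x k = ∑ j, A.adjugate k j * (v j - A.mulVec x j) := by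
    have h3 : A.det * x k = A.adjugate.mulVec (A.mulVec x) k := by rw [h1]; rfl
    rw [h3, Matrix.cramer_eq_adjugate_mulVec]
    simp only [Matrix.mulVec, dotProduct, mul_sub, Finset.sum_sub_distrib]
  have hB0 : 0 ≤ B := (norm_nonneg _).trans (hB k k)
  rw [h2]
  refine (norm_sum_le_of_le _ fun j _ => ?_).trans_eq (b := ∑ _j : n, B * ε) ?_
  · rw [norm_mul]
    exact mul_le_mul (hB k j) (h j) (norm_nonneg _) hB0
  · simp

theorem hasDerivAt_det {A : ℝ → Matrix n n ℂ} {A' : Matrix n n ℂ} {t : ℝ}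
    (h : ∀ i j, HasDerivAt (fun s => A s i j) (A' i j) t) :
    HasDerivAt (fun s => (A s).det) (∑ k, (A t).cramer (fun j => A' j k) k) t := by
  simp only [Matrix.det_apply', Matrix.cramer_apply]
  rw [Finset.sum_comm]
  refine HasDerivAt.fun_sum fun σ _ => ?_
  have h1 := (HasDerivAt.fun_finsetProd (u := Finset.univ) fun i _ => h (σ i) i).const_mul
    ((Equiv.Perm.sign σ : ℤ) : ℂ)
  refine h1.congr_deriv ?_
  rw [Finset.mul_sum]
  refine Finset.sum_congr rfl fun k _ => ?_
  rw [← Finset.mul_prod_erase _ _ (Finset.mem_univ k), smul_eq_mul, Matrix.updateCol_self,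
    mul_comm (A' (σ k) k)]
  congr 2
  refine Finset.prod_congr rfl fun i hi => ?_
  rw [Matrix.updateCol_ne (Finset.ne_of_mem_erase hi)]

end Determinants

/-! ### Toeplitz matrices -/

/-- The Toeplitz matrix with entries `u (j - k)`. -/
noncomputable def toep (u : ℤ → ℂ) (N : ℕ) : Matrix (Fin N) (Fin N) ℂ :=
  Matrix.of fun j k => u ((j : ℤ) - (k : ℤ))

@[simp]
theorem toep_apply (u : ℤ → ℂ) (N : ℕ) (j k : Fin N) : toep u N j k = u ((j : ℤ) - (k : ℤ)) := rfl

theorem det_toep_of_neg {u : ℤ → ℂ} (h : ∀ n < 0, u n = 0) (h0 : u 0 = 1) (N : ℕ) :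
    (toep u N).det = 1 := by
  rw [Matrix.det_of_isLowerTriangular _ fun i j hij => ?_]
  · simp [h0]
  · have : (i : ℕ) < j := hij
    exact h _ (by omega)

theorem det_toep_of_pos {u : ℤ → ℂ} (h : ∀ n > 0, u n = 0) (h0 : u 0 = 1) (N : ℕ) :
    (toep u N).det = 1 := by
  rw [Matrix.det_of_isUpperTriangular fun i j hij => ?_]
  · simp [h0]
  · have : (j : ℕ) < i := hij
    exact h _ (by omega)

/-- Only the negative indices escape the finite sum, and they are dominated by a geometric series.
With D = 0 the truncation is exact, which is how `toep_mul_toep` uses it. -/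
theorem norm_hasSum_sub_sum_fin_le {s : ℤ → ℂ} {A : ℂ} (hs : HasSum s A) {N : ℕ} {D ρ : ℝ}
    (h0 : 0 ≤ ρ) (h1 : ρ < 1) (hge : ∀ i : ℤ, (N : ℤ) ≤ i → s i = 0)
    (hneg : ∀ m : ℕ, ‖s (-(m + 1))‖ ≤ D * ρ ^ m) :
    ‖A - ∑ i : Fin N, s (i : ℤ)‖ ≤ D * (1 - ρ)⁻¹ := by
  have hpos : HasSum (fun n : ℕ => s n) (∑ i : Fin N, s (i : ℤ)) := by
    rw [Fin.sum_univ_eq_sum_range (fun i : ℕ => s i)]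
    refine hasSum_sum_of_ne_finset_zero fun b hb => hge _ ?_
    simpa using hb
  have hgeo := (hasSum_geometric_of_lt_one h0 h1).mul_left D
  have hn : Summable fun m : ℕ => s (-(m + 1)) := Summable.of_norm_bounded hgeo.summable hneg
  rw [← hs.tsum_eq, tsum_of_nat_of_neg_add_one hpos.summable hn, hpos.tsum_eq, add_sub_cancel_left]
  exact tsum_of_norm_bounded hgeo hneg

theorem hasSum_shift {a b : ℤ → ℂ} {c : ℤ → ℂ}
    (h : ∀ n, HasSum (fun k => a k * b (n - k)) (c n)) (j k : ℤ) :
    HasSum (fun i => a (j - i) * b (i - k)) (c (j - k)) := by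
  have h1 := (Equiv.subLeft j).hasSum_iff.2 (h (j - k))
  refine (congrArg (HasSum · _) (funext fun i => ?_)).mpr h1
  simp [Function.comp]

theorem toep_mul_toep {a b c : ℤ → ℂ} (h : ∀ n, HasSum (fun k => a k * b (n - k)) (c n)) {N : ℕ}
    (hz : ∀ j k : Fin N, ∀ i : ℤ, (i < 0 ∨ (N : ℤ) ≤ i) → a (j - i) * b (i - k) = 0) :
    toep a N * toep b N = toep c N := by
  ext j k
  have h1 := norm_hasSum_sub_sum_fin_le (hasSum_shift h j k) (N := N) (D := 0) le_rfl one_pos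
    (fun i hi => hz j k i (Or.inr hi))
    (fun m => by rw [hz j k _ (Or.inl (by omega))]; simp)
  rw [zero_mul, norm_le_zero_iff, sub_eq_zero] at h1
  rw [Matrix.mul_apply]
  exact h1.symm

/-- Wiener–Hopf factors of a Toeplitz symbol at the level of Fourier coefficients: `p` and `q` are
the coefficients of the factors, `p'` and `q'` those of their inverses, `u` those of the symbol. -/
structure WienerHopfData (C ρ : ℝ) (p p' q q' u : ℤ → ℂ) : Prop where
  p_neg : ∀ n < 0, p n = 0
  p'_neg : ∀ n < 0, p' n = 0
  q_pos : ∀ n > 0, q n = 0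
  q'_pos : ∀ n > 0, q' n = 0
  p_zero : p 0 = 1
  q_zero : q 0 = 1
  conv_p : ∀ n, HasSum (fun k => p k * p' (n - k)) (if n = 0 then 1 else 0)
  conv_q : ∀ n, HasSum (fun k => q k * q' (n - k)) (if n = 0 then 1 else 0)
  conv_u : ∀ n, HasSum (fun k => u k * q' (n - k)) (p n)
  p'_le : ∀ n, ‖p' n‖ ≤ C * ρ ^ n.natAbs
  q'_le : ∀ n, ‖q' n‖ ≤ C * ρ ^ n.natAbs
  u_le : ∀ n, ‖u n‖ ≤ C * ρ ^ n.natAbs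

namespace WienerHopfData

variable {C ρ : ℝ} {p p' q q' u : ℤ → ℂ}

theorem toep_ite (N : ℕ) : toep (fun n => if n = 0 then 1 else 0) N = 1 := by
  ext j k
  rw [toep_apply, Matrix.one_apply]
  refine if_congr ?_ rfl rfl
  rw [sub_eq_zero, Nat.cast_inj, Fin.val_inj]

theorem toep_p_mul (h : WienerHopfData C ρ p p' q q' u) (N : ℕ) : toep p N * toep p' N = 1 := by
  rw [toep_mul_toep h.conv_p, toep_ite]
  rintro j k i (hi | hi)
  · rw [h.p'_neg _ (by omega), mul_zero]
  · rw [h.p_neg _ (by omega), zero_mul]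

theorem toep_q_mul (h : WienerHopfData C ρ p p' q q' u) (N : ℕ) : toep q N * toep q' N = 1 := by
  rw [toep_mul_toep h.conv_q, toep_ite]
  rintro j k i (hi | hi)
  · rw [h.q_pos _ (by omega), zero_mul]
  · rw [h.q'_pos _ (by omega), mul_zero]

/-- The infinite product of the Toeplitz matrices of u and q' is that of p. Truncation loses only
the indices i = -(m+1), a product of two Hankel-type factors u(j+m+1) and q'(-(m+1)-k), small in
both j and k. -/
theorem norm_hankel_le (h : WienerHopfData C ρ p p' q q' u) (hC : 0 ≤ C) (h0 : 0 ≤ ρ) (h1 : ρ < 1)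
    (N : ℕ) (j k : Fin N) :
    ‖(toep p N - toep u N * toep q' N) j k‖ ≤ C ^ 2 * (1 - ρ)⁻¹ * ρ ^ ((j : ℕ) + (k : ℕ)) := by
  have key := norm_hasSum_sub_sum_fin_le (hasSum_shift h.conv_u j k) (N := N)
    (D := C ^ 2 * ρ ^ ((j : ℕ) + (k : ℕ))) h0 h1
    (fun i hi => by rw [h.q'_pos _ (by omega), mul_zero]) fun m => by
      rw [norm_mul]
      refine (mul_le_mul (h.u_le _) (h.q'_le _) (norm_nonneg _) (by positivity)).trans ?_
      rw [show ((j : ℤ) - -(m + 1)).natAbs = j + (m + 1) by omega,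
        show (-((m : ℤ) + 1) - k).natAbs = m + 1 + k by omega]
      calc C * ρ ^ ((j : ℕ) + (m + 1)) * (C * ρ ^ (m + 1 + (k : ℕ)))
          = C ^ 2 * ρ ^ ((j : ℕ) + k) * ρ ^ m * ρ ^ (m + 2) := by ring
        _ ≤ C ^ 2 * ρ ^ ((j : ℕ) + k) * ρ ^ m * 1 := by
          gcongr
          exact pow_le_one₀ h0 h1.le
        _ = _ := mul_one _
  rw [Matrix.sub_apply, Matrix.mul_apply]
  exact key.trans_eq (by ring)

/-- The matrix is 1 - toep p' * H with H the truncation defect. In row j the bounds ρ^{j-i} ρ^i over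
i ≤ j add up to (j+1) ρ^j, and ρ^k is summed over k. The excess over 1 is therefore summable in j,
uniformly in N. -/
theorem row_sum_le (h : WienerHopfData C ρ p p' q q' u) (hC : 0 ≤ C) (h0 : 0 ≤ ρ) (h1 : ρ < 1)
    (N : ℕ) (j : Fin N) :
    ∑ k, ‖(toep p' N * toep u N * toep q' N) j k‖ ≤
      1 + C ^ 3 * (1 - ρ)⁻¹ ^ 2 * (((j : ℕ) + 1) * ρ ^ (j : ℕ)) := by
  have h1' : 0 < (1 - ρ)⁻¹ := inv_pos.2 (by linarith)
  set H := toep p N - toep u N * toep q' N with hH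
  have hX : toep p' N * toep u N * toep q' N = 1 - toep p' N * H := by
    rw [hH, mul_sub, mul_eq_one_comm.1 (h.toep_p_mul N), mul_assoc]
    abel
  have hentry : ∀ k, ‖(toep p' N * H) j k‖ ≤
      C ^ 3 * (1 - ρ)⁻¹ * (((j : ℕ) + 1) * ρ ^ (j : ℕ)) * ρ ^ (k : ℕ) := fun k => by
    rw [Matrix.mul_apply]
    calc ‖∑ i, toep p' N j i * H i k‖
        ≤ ∑ i : Fin N, if (i : ℕ) ∈ Finset.range (j + 1) then
            C ^ 3 * (1 - ρ)⁻¹ * ρ ^ (j : ℕ) * ρ ^ (k : ℕ) else 0 := by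
          refine norm_sum_le_of_le _ fun i _ => ?_
          split_ifs with hi
          · rw [Finset.mem_range] at hi
            rw [norm_mul]
            refine (mul_le_mul (h.p'_le _) (h.norm_hankel_le hC h0 h1 N i k) (norm_nonneg _)
              (by positivity)).trans_eq ?_
            rw [show ((j : ℤ) - i).natAbs = j - i by omega]
            have : ρ ^ (j : ℕ) = ρ ^ ((j : ℕ) - i) * ρ ^ (i : ℕ) := by
              rw [← pow_add]; congr 1; omega
            rw [this]
            ring
          · rw [Finset.mem_range] at hi
            rw [toep_apply, h.p'_neg _ (by omega), zero_mul, norm_zero]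
      _ = ∑ i ∈ Finset.range N, if i ∈ Finset.range (j + 1) then
            C ^ 3 * (1 - ρ)⁻¹ * ρ ^ (j : ℕ) * ρ ^ (k : ℕ) else 0 :=
          Fin.sum_univ_eq_sum_range (fun i => if i ∈ Finset.range (j + 1) then
            C ^ 3 * (1 - ρ)⁻¹ * ρ ^ (j : ℕ) * ρ ^ (k : ℕ) else 0) N
      _ = _ := by
          rw [← Finset.sum_filter, Finset.filter_mem_eq_inter, Finset.inter_eq_right.2
            (Finset.range_subset_range.2 (by omega)), Finset.sum_const, Finset.card_range,
            nsmul_eq_mul]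
          push_cast
          ring
  calc ∑ k, ‖(toep p' N * toep u N * toep q' N) j k‖
      ≤ ∑ k : Fin N, (‖(1 : Matrix (Fin N) (Fin N) ℂ) j k‖ +
          C ^ 3 * (1 - ρ)⁻¹ * (((j : ℕ) + 1) * ρ ^ (j : ℕ)) * ρ ^ (k : ℕ)) := by
        refine Finset.sum_le_sum fun k _ => ?_
        rw [hX, Matrix.sub_apply]
        exact (norm_sub_le _ _).trans (by gcongr; exact hentry k)
    _ = 1 + C ^ 3 * (1 - ρ)⁻¹ * (((j : ℕ) + 1) * ρ ^ (j : ℕ)) * ∑ k : Fin N, ρ ^ (k : ℕ) := by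
        rw [Finset.sum_add_distrib, ← Finset.mul_sum]
        congr 1
        rw [Finset.sum_eq_single j] <;> simp +contextual [eq_comm]
    _ ≤ 1 + C ^ 3 * (1 - ρ)⁻¹ * (((j : ℕ) + 1) * ρ ^ (j : ℕ)) * (1 - ρ)⁻¹ := by
        gcongr
        rw [Fin.sum_univ_eq_sum_range (fun i => ρ ^ i), ← tsum_geometric_of_lt_one h0 h1]
        exact (summable_geometric_of_lt_one h0 h1).sum_le_tsum _ fun _ _ => by positivity
    _ = _ := by ring

end WienerHopfData

theorem summable_succ_mul_pow {ρ : ℝ} (h0 : 0 ≤ ρ) (h1 : ρ < 1) :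
    Summable fun j : ℕ => ((j : ℝ) + 1) * ρ ^ j := by
  have h := summable_pow_mul_geometric_of_norm_lt_one (R := ℝ) 1
    (by rwa [Real.norm_of_nonneg h0] : ‖ρ‖ < 1)
  simpa [add_mul] using h.add (summable_geometric_of_lt_one h0 h1)

/-- Reduce to X = toep p' * toep u * toep q', whose row sums have a bounded product. The bound
depends only on C and ρ, so it will be uniform along the deformation in t. -/
theorem exists_norm_adjugate_toep_le {C ρ : ℝ} (hC : 0 ≤ C) (h0 : 0 ≤ ρ) (h1 : ρ < 1) :
    ∃ B, 0 ≤ B ∧ ∀ p p' q q' u, WienerHopfData C ρ p p' q q' u → ∀ N,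
      ‖(toep u N).det‖ ≤ B ∧ ∀ i j, ‖(toep u N).adjugate i j‖ ≤ B * N ^ 2 := by
  set K := C ^ 3 * (1 - ρ)⁻¹ ^ 2 with hK
  have hK0 : 0 ≤ K := by positivity
  set B := Real.exp (∑' j : ℕ, K * (((j : ℝ) + 1) * ρ ^ j)) with hB
  have hs := (summable_succ_mul_pow h0 h1).mul_left K
  have hprod : ∀ N : ℕ, ∏ j : Fin N, (1 + K * (((j : ℕ) + 1) * ρ ^ (j : ℕ))) ≤ B := fun N => by
    rw [Fin.prod_univ_eq_prod_range (fun j : ℕ => 1 + K * (((j : ℝ) + 1) * ρ ^ j))]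
    calc ∏ j ∈ Finset.range N, (1 + K * (((j : ℝ) + 1) * ρ ^ j))
        ≤ ∏ j ∈ Finset.range N, Real.exp (K * (((j : ℝ) + 1) * ρ ^ j)) := by
          refine Finset.prod_le_prod (fun j _ => by positivity) fun j _ => ?_
          rw [add_comm]
          exact Real.add_one_le_exp _
      _ = Real.exp (∑ j ∈ Finset.range N, K * (((j : ℝ) + 1) * ρ ^ j)) :=
          (Real.exp_sum _ _).symm
      _ ≤ B := Real.exp_le_exp.2 (hs.sum_le_tsum _ fun _ _ => by positivity)
  have hB0 : 0 ≤ B := (Real.exp_pos _).le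
  refine ⟨B + C ^ 2 * B, by positivity, fun p p' q q' u h N => ?_⟩
  set X := toep p' N * toep u N * toep q' N with hX
  have hp1 := h.toep_p_mul N
  have hq1 := h.toep_q_mul N
  have hT : toep u N = toep p N * X * toep q N := by
    rw [hX, mul_assoc, mul_assoc (toep p' N * toep u N), mul_eq_one_comm.1 hq1, mul_one,
      ← mul_assoc, hp1, one_mul]
  have hdp := det_toep_of_neg h.p_neg h.p_zero N
  have hdq := det_toep_of_pos h.q_pos h.q_zero N
  have hrow := h.row_sum_le hC h0 h1 N
  -- For determinant one the adjugate is the inverse, so the adjugates of the triangular factors are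
  -- again Toeplitz with bounded entries.
  have hadj : ∀ {a b : Matrix (Fin N) (Fin N) ℂ}, a * b = 1 → a.det = 1 → a.adjugate = b :=
    fun {a b} hab hd => by
      rw [← mul_one a.adjugate, ← hab, ← mul_assoc, Matrix.adjugate_mul, hd, one_smul, one_mul]
  have hle : ∀ {a : ℤ → ℂ}, (∀ n, ‖a n‖ ≤ C * ρ ^ n.natAbs) → ∀ n, ‖a n‖ ≤ C := fun ha n =>
    (ha n).trans (mul_le_of_le_one_right hC (pow_le_one₀ h0 h1.le))
  constructor
  · rw [hT, Matrix.det_mul, Matrix.det_mul, hdp, hdq, one_mul, mul_one]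
    have := norm_det_le_of_row_sum_le hrow
    nlinarith [hprod N, mul_nonneg (sq_nonneg C) hB0]
  · intro i j
    rw [hT, Matrix.adjugate_mul_distrib, Matrix.adjugate_mul_distrib, hadj hp1 hdp, hadj hq1 hdq,
      Matrix.mul_apply]
    have hXb : ∀ a b, ‖X.adjugate a b‖ ≤ B := fun a b =>
      (norm_adjugate_le_of_row_sum_le (fun k => le_add_of_nonneg_right (by positivity)) hrow
        a b).trans (hprod N)
    calc ‖∑ a, toep q' N i a * (X.adjugate * toep p' N) a j‖
        ≤ ∑ _a : Fin N, C * (N * (B * C)) := by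
          refine norm_sum_le_of_le _ fun a _ => ?_
          rw [norm_mul]
          refine mul_le_mul (hle h.q'_le _) ?_ (norm_nonneg _) hC
          rw [Matrix.mul_apply]
          refine (norm_sum_le_of_le _ (f := fun b => X.adjugate a b * toep p' N b j)
            (n := fun _ => B * C) fun b _ => ?_).trans_eq (by simp)
          rw [norm_mul]
          exact mul_le_mul (hXb a b) (hle h.p'_le _) (norm_nonneg _) hB0
      _ = C ^ 2 * B * N ^ 2 := by
          rw [Finset.sum_const, Finset.card_univ, Fintype.card_fin, nsmul_eq_mul]
          ring
      _ ≤ _ := by gcongr; linarith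

/-- A solution of the semi-infinite Toeplitz system gives the components of the solution of the
finite system by Cramer's rule up to an exponentially small error. -/
theorem norm_cramer_toep_sub_le {C B D ρ : ℝ} (hC : 0 ≤ C) (h0 : 0 ≤ ρ) (h1 : ρ < 1)
    {u : ℤ → ℂ} {N : ℕ} (hu : ∀ n, ‖u n‖ ≤ C)
    (hadj : ∀ i j, ‖(toep u N).adjugate i j‖ ≤ B * N ^ 2) {x v : ℕ → ℂ}
    (hx : ∀ j : ℕ, j < N → HasSum (fun i : ℕ => u ((j : ℤ) - i) * x i) (v j))
    (hxN : ∀ i, N ≤ i → ‖x i‖ ≤ D * ρ ^ i) (k : Fin N) :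
    ‖(toep u N).cramer (fun j => v j) k - (toep u N).det * x k‖ ≤
      B * C * D * (1 - ρ)⁻¹ * (N ^ 3 * ρ ^ N) := by
  refine (norm_cramer_sub_le (x := fun i : Fin N => x i) (v := fun i : Fin N => v i) (ε := C * D * ρ ^ N * (1 - ρ)⁻¹)
    hadj (fun j => ?_) k).trans_eq ?_
  · have hj := hx j j.2
    have hs : HasSum (fun m : ℕ => C * D * ρ ^ N * ρ ^ m) (C * D * ρ ^ N * (1 - ρ)⁻¹) :=
      (hasSum_geometric_of_lt_one h0 h1).mul_left _
    have hsum : (toep u N).mulVec (fun i => x i) j =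
        ∑ i ∈ Finset.range N, u ((j : ℤ) - i) * x i :=
      Fin.sum_univ_eq_sum_range (fun i : ℕ => u ((j : ℤ) - i) * x i) N
    rw [hsum, ← hj.tsum_eq, ← hj.summable.sum_add_tsum_nat_add N, add_sub_cancel_left]
    refine tsum_of_norm_bounded hs fun m => ?_
    rw [norm_mul, mul_assoc C, mul_assoc C, mul_assoc D, ← pow_add, add_comm N]
    exact mul_le_mul (hu _) (hxN _ (by omega)) (norm_nonneg _) hC
  · rw [Fintype.card_fin]
    ring

/-! ### Solution of the semi-infinite Toeplitz system by Wiener–Hopf factorization -/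

/-- Wiener–Hopf: with w the projection of χ onto nonnegative frequencies and Q = 1/P, the solution
is the coefficient sequence of wQ, because PM·wQ = Mw differs from Mχ only in negative frequencies.
The second conclusion, the series of (χ - w)Q, provides the decay of x. -/
theorem exists_toeplitz_solution {P Q M χ : ℂ → ℂ} (hP : ∀ z ∈ sphere (0 : ℂ) 1, P z * Q z = 1)
    (hQ : IsWiener Q) (hM : IsWiener M) (hχ : IsWiener χ) (hPM : IsWiener fun z => P z * M z)
    (hneg : ∀ n < 0, fourierCoef Q n = 0) (hpos : ∀ n > 0, fourierCoef M n = 0) :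
    ∃ x : ℕ → ℂ,
      (∀ j : ℕ, HasSum (fun i : ℕ => fourierCoef (fun z => P z * M z) ((j : ℤ) - i) * x i)
        (fourierCoef (fun z => M z * χ z) j)) ∧
      (∀ i : ℕ, HasSum (fun m : ℕ => fourierCoef χ (-(m + 1)) * fourierCoef Q (i + (m + 1)))
        (fourierCoef (fun z => χ z * Q z) i - x i)) ∧
      x 0 = fourierCoef χ 0 * fourierCoef Q 0 := by
  obtain ⟨w, hw, hwc⟩ := exists_nonneg_projection hχ
  have hwP : ContinuousOn (fun z => w z * Q z) (sphere 0 1) :=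
    hw.continuousOn.mul hQ.continuousOn
  have hsub : ContinuousOn (fun z => χ z - w z) (sphere 0 1) :=
    hχ.continuousOn.sub hw.continuousOn
  have hsubc : ∀ n, fourierCoef (fun z => χ z - w z) n = if 0 ≤ n then 0 else fourierCoef χ n :=
    fun n => by
      rw [fourierCoef_sub hχ.continuousOn hw.continuousOn, hwc]
      split_ifs <;> simp
  have hsubW : IsWiener fun z => χ z - w z := by
    refine ⟨hsub, hχ.summable.of_nonneg_of_le (fun _ => norm_nonneg _) fun n => ?_⟩
    rw [hsubc]
    split_ifs <;> simp
  have hxneg : ∀ n < 0, fourierCoef (fun z => w z * Q z) n = 0 := fun n hn => by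
    refine (hw.hasSum_mul hQ.continuousOn n).unique ?_
    convert hasSum_zero (α := ℂ) (β := ℤ) with k
    rw [hwc]
    split_ifs with hk
    · rw [hneg _ (by omega), mul_zero]
    · rw [zero_mul]
  refine ⟨fun i => fourierCoef (fun z => w z * Q z) i, fun j => ?_, fun i => ?_, ?_⟩
  · have h1 := hPM.hasSum_mul hwP j
    have h2 : fourierCoef (fun z => P z * M z * (w z * Q z)) j =
        fourierCoef (fun z => M z * χ z) j := by
      -- M has frequencies ≤ 0 and χ - w has frequencies < 0.
      have h3 : fourierCoef (fun z => M z * (χ z - w z)) j = 0 := by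
        refine (hM.hasSum_mul hsub j).unique ?_
        convert hasSum_zero (α := ℂ) (β := ℤ) with k
        rw [hsubc]
        split_ifs with hk
        · rw [mul_zero]
        · rw [hpos _ (by omega), zero_mul]
      have h4 : fourierCoef (fun z => M z * χ z) j =
          fourierCoef (fun z => M z * w z + M z * (χ z - w z)) j := by
        congr 1
        ext z
        ring
      rw [h4, fourierCoef_add (f := fun z => M z * w z) (g := fun z => M z * (χ z - w z))
        (hM.continuousOn.mul hw.continuousOn) (hM.continuousOn.mul hsub), h3,
        add_zero]
      refine fourierCoef_congr (fun z hz => ?_) _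
      linear_combination M z * w z * hP z hz
    rw [h2, ← (Equiv.subLeft (j : ℤ)).hasSum_iff] at h1
    rw [← Nat.cast_injective.hasSum_iff] at h1
    · refine (congrArg (HasSum · _) (funext fun i => ?_)).mpr h1
      simp [Function.comp]
    · intro i hi
      have : i < 0 := by
        by_contra h
        exact hi ⟨i.toNat, Int.toNat_of_nonneg (by omega)⟩
      simp [Function.comp, hxneg i this]
  · have h1 := hsubW.hasSum_mul hQ.continuousOn i
    have h2 : fourierCoef (fun z => (χ z - w z) * Q z) i =
        fourierCoef (fun z => χ z * Q z) i - fourierCoef (fun z => w z * Q z) i := by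
      simp only [sub_mul]
      exact fourierCoef_sub (hχ.continuousOn.mul hQ.continuousOn) hwP _
    have hinj : Function.Injective fun m : ℕ => -((m : ℤ) + 1) := fun a b hab => by
      simpa using hab
    rw [h2, ← hinj.hasSum_iff] at h1
    · refine (congrArg (HasSum · _) (funext fun m => ?_)).mpr h1
      simp only [Function.comp, hsubc]
      rw [if_neg (by omega), sub_neg_eq_add]
    · intro n hn
      have : 0 ≤ n := by
        by_contra h
        exact hn ⟨(-n - 1).toNat, by simp only; omega⟩
      rw [hsubc, if_pos this, zero_mul]
  · refine (hw.hasSum_mul hQ.continuousOn 0).unique ?_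
    convert hasSum_single (0 : ℤ) fun k hk => ?_ using 1
    · simp [hwc]
    · rw [hwc]
      split_ifs with h
      · rw [hneg _ (by omega), mul_zero]
      · rw [zero_mul]

theorem norm_toeplitz_solution_sub_le {C D ρ : ℝ} (hD : 0 ≤ D) (h0 : 0 ≤ ρ)
    (h1 : ρ < 1) {a b : ℤ → ℂ} (ha : ∀ m : ℕ, ‖a (-(m + 1))‖ ≤ D) (hb : ∀ n, ‖b n‖ ≤ C * ρ ^ n.natAbs)
    {i : ℕ} {y : ℂ} (h : HasSum (fun m : ℕ => a (-(m + 1)) * b (i + (m + 1))) y) :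
    ‖y‖ ≤ D * C * (1 - ρ)⁻¹ * ρ ^ i := by
  have hC : 0 ≤ C := by simpa using (norm_nonneg _).trans (hb 0)
  have hs : HasSum (fun m : ℕ => D * C * ρ ^ i * ρ ^ m) (D * C * ρ ^ i * (1 - ρ)⁻¹) :=
    (hasSum_geometric_of_lt_one h0 h1).mul_left _
  rw [← h.tsum_eq]
  refine (tsum_of_norm_bounded hs fun m => ?_).trans_eq (by ring)
  rw [norm_mul]
  refine (mul_le_mul (ha m) (hb _) (norm_nonneg _) hD).trans ?_
  rw [show ((i : ℤ) + (m + 1)).natAbs = i + m + 1 by omega, pow_succ, pow_add]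
  calc D * (C * (ρ ^ i * ρ ^ m * ρ)) = D * C * ρ ^ i * ρ ^ m * ρ := by ring
    _ ≤ D * C * ρ ^ i * ρ ^ m * 1 := by gcongr
    _ = _ := mul_one _

/-! ### Estimates and differentiation for the deformation argument -/

/-- Since y_k = ∑_{p>k} s_p, the sum of y_k over k < N is ∑ min(N,p) s_p, and the error is the sum
of (p-N) s_p over p > N. -/
theorem exists_norm_sub_sum_tail_le {D ρ : ℝ} (hD : 0 ≤ D) (h0 : 0 ≤ ρ) (h1 : ρ < 1) :
    ∃ K, 0 ≤ K ∧ ∀ (s : ℕ → ℂ) (y : ℕ → ℂ) (S : ℂ), (∀ p, ‖s p‖ ≤ D * ρ ^ p * ρ ^ p) →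
      (∀ k, HasSum (fun m => s (m + (k + 1))) (y k)) → HasSum (fun p : ℕ => (p : ℂ) * s p) S →
      ∀ N : ℕ, ‖S - ∑ k : Fin N, y k‖ ≤ K * ρ ^ N := by
  have hsum := (summable_succ_mul_pow h0 h1).mul_left D
  refine ⟨∑' p : ℕ, D * (((p : ℝ) + 1) * ρ ^ p), tsum_nonneg fun _ => by positivity,
    fun s y S hs hy hS N => ?_⟩
  have hyk : ∀ k, HasSum (fun p => if k < p then s p else 0) (y k) := fun k => by
    rw [← hasSum_nat_add_iff' (k + 1), Finset.sum_eq_zero, sub_zero]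
    · refine (congrArg (HasSum · _) (funext fun m => ?_)).mpr (hy k)
      rw [if_pos (by omega)]
    · intro p hp
      rw [Finset.mem_range] at hp
      rw [if_neg (by omega)]
  have hdiff := hS.sub (hasSum_sum (s := Finset.range N) fun k _ => hyk k)
  rw [Fin.sum_univ_eq_sum_range y N, ← hdiff.tsum_eq]
  rw [mul_comm, ← tsum_mul_left]
  refine tsum_of_norm_bounded (hsum.mul_left _).hasSum fun p => ?_
  have hcard : (∑ k ∈ Finset.range N, if k < p then s p else 0) = (min N p : ℕ) * s p := by
    rw [← Finset.sum_filter, Finset.sum_const, nsmul_eq_mul]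
    congr 2
    rw [← Finset.card_range (min N p)]
    congr 1
    ext k
    simp
  rw [hcard, ← sub_mul]
  rcases le_or_gt p N with hp | hp
  · rw [min_eq_right hp, sub_self, zero_mul, norm_zero]
    positivity
  · rw [min_eq_left hp.le, ← Nat.cast_sub hp.le, norm_mul, Complex.norm_natCast]
    -- One of the two factors ρ^p becomes ρ^N; the other keeps the series convergent.
    calc ((p - N : ℕ) : ℝ) * ‖s p‖ ≤ (p + 1) * (D * ρ ^ p * ρ ^ N) := by
          refine mul_le_mul ?_ ((hs p).trans ?_) (norm_nonneg _) (by positivity)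
          · have : p - N ≤ p + 1 := by omega
            exact_mod_cast this
          · exact mul_le_mul_of_nonneg_left (pow_le_pow_of_le_one h0 h1.le hp.le) (by positivity)
      _ = _ := by ring

/-- Absorbs the polynomial factors from adjugates and sums over columns at the price of a slightly
worse rate. -/
theorem exists_pow_mul_pow_le {ρ ρ₁ : ℝ} (h0 : 0 ≤ ρ) (h1 : ρ < ρ₁) (d : ℕ) :
    ∃ K, 0 ≤ K ∧ ∀ N : ℕ, (N : ℝ) ^ d * ρ ^ N ≤ K * ρ₁ ^ N := by
  have hρ₁ : 0 < ρ₁ := h0.trans_lt h1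
  have h := (summable_pow_mul_geometric_of_norm_lt_one (R := ℝ) d (r := ρ / ρ₁) (by
    rw [Real.norm_of_nonneg (by positivity)]
    exact (div_lt_one hρ₁).2 h1))
  refine ⟨∑' N : ℕ, (N : ℝ) ^ d * (ρ / ρ₁) ^ N, tsum_nonneg fun _ => by positivity, fun N => ?_⟩
  have h2 := h.le_tsum N fun _ _ => by positivity
  have h3 : ρ ^ N = (ρ / ρ₁) ^ N * ρ₁ ^ N := by rw [← mul_pow, div_mul_cancel₀ _ hρ₁.ne']
  rw [h3, ← mul_assoc]
  gcongr

theorem hasDerivAt_fourierCoef_exp {g h : ℂ → ℂ} (hg : ContinuousOn g (sphere 0 1))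
    (hh : ContinuousOn h (sphere 0 1)) (n : ℤ) (t : ℝ) :
    HasDerivAt (fun s : ℝ => fourierCoef (fun z => Complex.exp (g z + s * h z)) n)
      (fourierCoef (fun z => Complex.exp (g z + t * h z) * h z) n) t := by
  obtain ⟨A, hA0, hA⟩ := exists_norm_le_unitSphere hg
  obtain ⟨B, hB0, hB⟩ := exists_norm_le_unitSphere hh
  have hc : ∀ s : ℝ, ContinuousOn (fun z => Complex.exp (g z + s * h z)) (sphere 0 1) := fun s =>
    (hg.add (continuousOn_const.mul hh)).cexp
  have hc1 := fun s : ℝ => continuous_fourier_integrand (hc s) (-n)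
  have hc2 := fun s : ℝ => continuous_fourier_integrand ((hc s).mul hh) (-n)
  simp only [fourierCoef_eq_integral]
  refine HasDerivAt.const_mul _ ?_
  refine (intervalIntegral.hasDerivAt_integral_of_dominated_loc_of_deriv_le (μ := volume)
    (F := fun (s : ℝ) (θ : ℝ) => circleMap 0 1 θ ^ (-n) *
      Complex.exp (g (circleMap 0 1 θ) + s * h (circleMap 0 1 θ)))
    (F' := fun (s : ℝ) (θ : ℝ) => circleMap 0 1 θ ^ (-n) *
      (Complex.exp (g (circleMap 0 1 θ) + s * h (circleMap 0 1 θ)) * h (circleMap 0 1 θ)))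
    (bound := fun _ => Real.exp (A + (|t| + 1) * B) * B)
    (ball_mem_nhds t one_pos) (Eventually.of_forall fun s => (hc1 s).aestronglyMeasurable)
    ((hc1 t).intervalIntegrable _ _) (hc2 t).aestronglyMeasurable
    (ae_of_all _ fun θ _ s hs => ?_) intervalIntegrable_const (ae_of_all _ fun θ _ s _ => ?_)).2
  · have hz := circleMap_mem_unitSphere θ
    rw [norm_mul, norm_mul, norm_zpow, norm_circleMap_zero, abs_one, one_zpow, one_mul,
      Complex.norm_exp]
    have hs' : ‖(s : ℂ)‖ ≤ |t| + 1 := by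
      rw [mem_ball, Real.dist_eq] at hs
      rw [Complex.norm_real, Real.norm_eq_abs]
      linarith [abs_sub_abs_le_abs_sub s t]
    refine mul_le_mul (Real.exp_le_exp.2 ?_) (hB _ hz) (norm_nonneg _) (Real.exp_pos _).le
    refine (Complex.re_le_norm _).trans ((norm_add_le _ _).trans ?_)
    rw [norm_mul]
    exact add_le_add (hA _ hz) (mul_le_mul hs' (hB _ hz) (norm_nonneg _) (by positivity))
  · refine HasDerivAt.const_mul _ ?_
    have h1 : HasDerivAt (fun s : ℝ => g (circleMap 0 1 θ) + s * h (circleMap 0 1 θ))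
        (h (circleMap 0 1 θ)) s := by
      simpa using ((Complex.ofRealCLM.hasDerivAt (x := s)).mul_const
        (h (circleMap 0 1 θ))).const_add (g (circleMap 0 1 θ))
    exact h1.cexp

theorem exists_decay_of_annulus {f : ℂ → ℂ} {R : ℝ} (hR : 1 < R)
    (hf : ∀ z : ℂ, R⁻¹ ≤ ‖z‖ → ‖z‖ ≤ R → DifferentiableAt ℂ f z) :
    ∃ C, 0 ≤ C ∧ ∀ n, ‖fourierCoef f n‖ ≤ C * R⁻¹ ^ n.natAbs := by
  have hcomp : IsCompact (closedBall (0 : ℂ) R \ ball 0 R⁻¹) :=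
    (isCompact_closedBall _ _).diff isOpen_ball
  have hmem : ∀ z : ℂ, z ∈ closedBall (0 : ℂ) R \ ball 0 R⁻¹ ↔ ‖z‖ ≤ R ∧ R⁻¹ ≤ ‖z‖ := by simp
  obtain ⟨C, hC⟩ := hcomp.exists_bound_of_continuousOn (f := f) fun z hz =>
    (hf z ((hmem z).1 hz).2 ((hmem z).1 hz).1).continuousAt.continuousWithinAt
  have h := norm_fourierCoef_le_of_annulus hR hf fun z h1 h2 => hC z ((hmem z).2 ⟨h2, h1⟩)
  exact ⟨C, by simpa using (norm_nonneg _).trans (h 0), h⟩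

theorem continuousOn_unitSphere_of_annulus {f : ℂ → ℂ} {R : ℝ} (hR : 1 < R)
    (hf : ∀ z : ℂ, R⁻¹ ≤ ‖z‖ → ‖z‖ ≤ R → DifferentiableAt ℂ f z) :
    ContinuousOn f (sphere 0 1) := fun z hz => by
  rw [mem_sphere_zero_iff_norm] at hz
  exact (hf z (hz ▸ (inv_lt_one_of_one_lt₀ hR).le) (hz ▸ hR.le)).continuousAt.continuousWithinAt

theorem IsWiener.of_annulus {f : ℂ → ℂ} {R : ℝ} (hR : 1 < R)
    (hf : ∀ z : ℂ, R⁻¹ ≤ ‖z‖ → ‖z‖ ≤ R → DifferentiableAt ℂ f z) : IsWiener f := by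
  obtain ⟨C, -, hC⟩ := exists_decay_of_annulus hR hf
  exact .of_decay (continuousOn_unitSphere_of_annulus hR hf)
    (inv_nonneg.2 (one_pos.trans hR).le) (inv_lt_one_of_one_lt₀ hR) hC

/-- The two analytic parts of a logarithm with vanishing mean, `log φ(z) = g(z) + k(1/z)` on the
unit circle. -/
structure LogParts (g k : ℂ → ℂ) (R R₁ A : ℝ) : Prop where
  one_lt : 1 < R
  lt : R < R₁
  g_diff : DifferentiableOn ℂ g (ball 0 R₁)
  k_diff : DifferentiableOn ℂ k (ball 0 R₁)
  g_zero : g 0 = 0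
  k_zero : k 0 = 0
  g_le : ∀ z ∈ closedBall (0 : ℂ) R, ‖g z‖ ≤ A
  k_le : ∀ z ∈ closedBall (0 : ℂ) R, ‖k z‖ ≤ A

/-! ### The strong Szegő limit theorem by deformation, and replacement of the first column -/

namespace LogParts

open Complex (exp)

variable {g k : ℂ → ℂ} {R R₁ A : ℝ}

theorem one_lt' (h : LogParts g k R R₁ A) : 1 < R₁ := h.one_lt.trans h.lt

theorem rate_nonneg (h : LogParts g k R R₁ A) : 0 ≤ R⁻¹ := inv_nonneg.2 (by linarith [h.one_lt])

theorem rate_lt_one (h : LogParts g k R R₁ A) : R⁻¹ < 1 := inv_lt_one_of_one_lt₀ h.one_lt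

theorem nonneg (h : LogParts g k R R₁ A) : 0 ≤ A :=
  (norm_nonneg _).trans (h.g_le 0 (by simp; linarith [h.one_lt]))

theorem inv_norm_le (h : LogParts g k R R₁ A) {z : ℂ} (h1 : R⁻¹ ≤ ‖z‖) :
    ‖z⁻¹‖ ≤ R := by
  rw [norm_inv]
  exact inv_le_of_inv_le₀ (by linarith [h.one_lt]) h1

theorem differentiableAt_g (h : LogParts g k R R₁ A) {z : ℂ} (h2 : ‖z‖ ≤ R) :
    DifferentiableAt ℂ g z :=
  h.g_diff.differentiableAt (isOpen_ball.mem_nhds (by simpa using h2.trans_lt h.lt))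

theorem differentiableAt_deriv_g (h : LogParts g k R R₁ A) {z : ℂ} (h2 : ‖z‖ ≤ R) :
    DifferentiableAt ℂ (deriv g) z :=
  (h.g_diff.deriv isOpen_ball).differentiableAt
    (isOpen_ball.mem_nhds (by simpa using h2.trans_lt h.lt))

theorem differentiableAt_k_inv (h : LogParts g k R R₁ A) {z : ℂ} (h1 : R⁻¹ ≤ ‖z‖) :
    DifferentiableAt ℂ (fun z => k z⁻¹) z := by
  have hz : z ≠ 0 := norm_pos_iff.1 ((inv_pos.2 (by linarith [h.one_lt])).trans_le h1)
  have hd : DifferentiableAt ℂ k z⁻¹ := h.k_diff.differentiableAt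
    (isOpen_ball.mem_nhds (by simpa using (h.inv_norm_le h1).trans_lt h.lt))
  exact hd.comp z (differentiableAt_inv hz)

theorem norm_g_le (h : LogParts g k R R₁ A) {z : ℂ} (h2 : ‖z‖ ≤ R) :
    ‖g z‖ ≤ A := h.g_le z (by simpa using h2)

theorem norm_k_inv_le (h : LogParts g k R R₁ A) {z : ℂ} (h1 : R⁻¹ ≤ ‖z‖) :
    ‖k z⁻¹‖ ≤ A := h.k_le _ (mem_closedBall_zero_iff.2 (h.inv_norm_le h1))

theorem norm_exp_le {w : ℂ} {B : ℝ} (hw : ‖w‖ ≤ B) : ‖exp w‖ ≤ Real.exp B := by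
  rw [Complex.norm_exp]
  exact Real.exp_le_exp.2 ((Complex.re_le_norm w).trans hw)

theorem norm_t_mul_le (h : LogParts g k R R₁ A) {t : ℝ} (ht : |t| ≤ 1) {z : ℂ} (h1 : R⁻¹ ≤ ‖z‖) :
    ‖t * k z⁻¹‖ ≤ A := by
  rw [norm_mul, Complex.norm_real, Real.norm_eq_abs]
  exact (mul_le_mul ht (h.norm_k_inv_le h1) (norm_nonneg _) zero_le_one).trans_eq (one_mul A)

theorem isWiener_exp_g (h : LogParts g k R R₁ A) : IsWiener fun z => exp (g z) :=
  .of_annulus h.one_lt fun _ _ h2 => (h.differentiableAt_g h2).cexp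

theorem isWiener_exp_neg_g (h : LogParts g k R R₁ A) : IsWiener fun z => exp (-g z) :=
  .of_annulus h.one_lt fun _ _ h2 => (h.differentiableAt_g h2).neg.cexp

theorem isWiener_exp_k (h : LogParts g k R R₁ A) (t : ℂ) : IsWiener fun z => exp (t * k z⁻¹) :=
  .of_annulus h.one_lt fun _ h1 _ => ((h.differentiableAt_k_inv h1).const_mul t).cexp

theorem isWiener_exp (h : LogParts g k R R₁ A) (t : ℂ) :
    IsWiener fun z => exp (g z) * exp (t * k z⁻¹) :=
  .of_annulus h.one_lt fun _ h1 h2 => (h.differentiableAt_g h2).cexp.mul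
    ((h.differentiableAt_k_inv h1).const_mul t).cexp

theorem fourierCoef_exp_neg_g_of_neg (h : LogParts g k R R₁ A) {n : ℤ} (hn : n < 0) :
    fourierCoef (fun z => exp (-g z)) n = 0 :=
  fourierCoef_of_neg h.one_lt' h.g_diff.neg.cexp hn

theorem fourierCoef_exp_k_of_pos (h : LogParts g k R R₁ A) (t : ℂ) {n : ℤ} (hn : 0 < n) :
    fourierCoef (fun z => exp (t * k z⁻¹)) n = 0 := by
  rw [fourierCoef_comp_inv fun z => exp (t * k z)]
  exact fourierCoef_of_neg h.one_lt' (h.k_diff.const_mul t).cexp (by omega)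

/-- The constant bounds all |t| ≤ 1 at once, because |g(z) + t k(1/z)| ≤ 2A on the annulus. -/
theorem wienerHopfData (h : LogParts g k R R₁ A) {t : ℝ} (ht : |t| ≤ 1) :
    WienerHopfData (Real.exp (A + A)) R⁻¹
      (fourierCoef fun z => exp (g z)) (fourierCoef fun z => exp (-g z))
      (fourierCoef fun z => exp (t * k z⁻¹)) (fourierCoef fun z => exp (-t * k z⁻¹))
      (fourierCoef fun z => exp (g z) * exp (t * k z⁻¹)) where
  p_neg _ hn := fourierCoef_of_neg h.one_lt' h.g_diff.cexp hn
  p'_neg _ hn := h.fourierCoef_exp_neg_g_of_neg hn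
  q_pos _ hn := h.fourierCoef_exp_k_of_pos t hn
  q'_pos _ hn := h.fourierCoef_exp_k_of_pos (-t) hn
  p_zero := by rw [fourierCoef_zero_of_disc h.one_lt' h.g_diff.cexp, h.g_zero, Complex.exp_zero]
  q_zero := by
    rw [fourierCoef_comp_inv fun z => exp (t * k z), neg_zero,
      fourierCoef_zero_of_disc h.one_lt' (h.k_diff.const_mul _).cexp, h.k_zero, mul_zero,
      Complex.exp_zero]
  conv_p n := by
    simpa [← Complex.exp_add, fourierCoef_one] using
      h.isWiener_exp_g.hasSum_mul h.isWiener_exp_neg_g.continuousOn n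
  conv_q n := by
    simpa [← Complex.exp_add, fourierCoef_one] using
      (h.isWiener_exp_k t).hasSum_mul (h.isWiener_exp_k (-t)).continuousOn n
  conv_u n := by
    have h1 := (h.isWiener_exp t).hasSum_mul (h.isWiener_exp_k (-t)).continuousOn n
    have h2 : ∀ z, exp (g z) * exp (t * k z⁻¹) * exp (-t * k z⁻¹) = exp (g z) := fun z => by
      rw [← Complex.exp_add, ← Complex.exp_add]
      congr 1
      ring
    simpa only [h2] using h1
  p'_le := norm_fourierCoef_le_of_annulus h.one_lt
    (fun _ _ h2 => (h.differentiableAt_g h2).neg.cexp)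
    fun _ _ h2 => norm_exp_le (by rw [norm_neg]; linarith [h.norm_g_le h2, h.nonneg])
  q'_le := norm_fourierCoef_le_of_annulus h.one_lt
    (fun _ h1 _ => ((h.differentiableAt_k_inv h1).const_mul _).cexp)
    fun _ h1 _ => norm_exp_le (by
      rw [neg_mul, norm_neg]
      linarith [h.norm_t_mul_le ht h1, h.nonneg])
  u_le := norm_fourierCoef_le_of_annulus h.one_lt
    (fun _ h1 h2 => (h.differentiableAt_g h2).cexp.mul
      ((h.differentiableAt_k_inv h1).const_mul _).cexp)
    fun _ h1 h2 => by
      rw [← Complex.exp_add]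
      exact norm_exp_le ((norm_add_le _ _).trans (add_le_add (h.norm_g_le h2)
        (h.norm_t_mul_le ht h1)))

/-- The exponent of the constant in the strong Szegő limit theorem. -/
noncomputable def szegoExponent (g k : ℂ → ℂ) : ℂ :=
  fourierCoef (fun z => z * deriv g z * k z⁻¹) 0

theorem norm_fourierCoef_exp_mul_k_le (h : LogParts g k R R₁ A) (n : ℤ) :
    ‖fourierCoef (fun z => exp (g z) * k z⁻¹) n‖ ≤ Real.exp A * A * R⁻¹ ^ n.natAbs :=
  norm_fourierCoef_le_of_annulus h.one_lt
    (fun _ h1 h2 => (h.differentiableAt_g h2).cexp.mul (h.differentiableAt_k_inv h1))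
    (fun _ h1 h2 => by
      refine (norm_mul _ _).trans_le ?_
      exact mul_le_mul (norm_exp_le (h.norm_g_le h2)) (h.norm_k_inv_le h1) (norm_nonneg _)
        (Real.exp_pos _).le) n

theorem norm_fourierCoef_exp_neg_g_le (h : LogParts g k R R₁ A) (n : ℤ) :
    ‖fourierCoef (fun z => exp (-g z)) n‖ ≤ Real.exp (A + A) * R⁻¹ ^ n.natAbs :=
  (h.wienerHopfData (t := 0) (by simp)).p'_le n

/-- The terms of the trace: `x_k = ∑_{p > k} traceTerm p`. -/
noncomputable def traceTerm (g k : ℂ → ℂ) (p : ℕ) : ℂ :=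
  -(fourierCoef (fun z => exp (g z) * k z⁻¹) (-p) * fourierCoef (fun z => exp (-g z)) p)

theorem norm_traceTerm_le (h : LogParts g k R R₁ A) (p : ℕ) :
    ‖traceTerm g k p‖ ≤ Real.exp A * A * Real.exp (A + A) * R⁻¹ ^ p * R⁻¹ ^ p := by
  have hA := h.nonneg
  have hR := h.rate_nonneg
  rw [traceTerm, norm_neg, norm_mul]
  refine (mul_le_mul (h.norm_fourierCoef_exp_mul_k_le _) (h.norm_fourierCoef_exp_neg_g_le _)
    (norm_nonneg _) (by positivity)).trans_eq ?_
  rw [Int.natAbs_neg, Int.natAbs_natCast]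
  ring

/-- The factor p is absorbed as p (e^{-g})_p = (z (e^{-g})')_p. The sum is then the mean of -z
(e^{-g})' e^g k(1/z) = z g' k(1/z). -/
theorem hasSum_traceTerm (h : LogParts g k R R₁ A) :
    HasSum (fun p : ℕ => (p : ℂ) * traceTerm g k p) (szegoExponent g k) := by
  have hderiv : ∀ z ∈ ball (0 : ℂ) R₁, deriv (fun z => exp (-g z)) z = exp (-g z) * -deriv g z :=
    fun z hz => ((h.g_diff.differentiableAt (isOpen_ball.mem_nhds hz)).hasDerivAt.neg.cexp).deriv
  have hdiff : DifferentiableOn ℂ (fun z => z * deriv (fun z => exp (-g z)) z) (ball 0 R₁) :=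
    differentiableOn_id.mul (h.g_diff.neg.cexp.deriv isOpen_ball)
  have hW : IsWiener fun z => z * deriv (fun z => exp (-g z)) z :=
    .of_annulus h.one_lt fun z _ h2 => hdiff.differentiableAt
      (isOpen_ball.mem_nhds (by simpa using h2.trans_lt h.lt))
  have hsub : sphere (0 : ℂ) 1 ⊆ ball 0 R₁ :=
    sphere_subset_closedBall.trans (closedBall_one_subset h.one_lt')
  have hcoef := fourierCoef_mul_deriv (f := fun z => exp (-g z))
    (fun z hz => (h.g_diff.differentiableAt (isOpen_ball.mem_nhds (hsub hz))).neg.cexp)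
    hW.continuousOn
  have hc : ContinuousOn (fun z => exp (g z) * k z⁻¹) (sphere 0 1) :=
    continuousOn_unitSphere_of_annulus h.one_lt fun _ h1 h2 =>
      (h.differentiableAt_g h2).cexp.mul (h.differentiableAt_k_inv h1)
  have h1 := (hW.hasSum_mul hc 0).neg
  have h2 : -fourierCoef (fun z => z * deriv (fun z => exp (-g z)) z * (exp (g z) * k z⁻¹)) 0 =
      szegoExponent g k := by
    rw [szegoExponent, ← neg_one_mul, ← fourierCoef_const_mul]
    refine fourierCoef_congr (fun z hz => ?_) 0
    have he : exp (-g z) * exp (g z) = 1 := by rw [← Complex.exp_add]; simp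
    simp only [hderiv z (hsub hz)]
    linear_combination z * deriv g z * k z⁻¹ * he
  rw [h2, ← Nat.cast_injective.hasSum_iff] at h1
  · refine (congrArg (HasSum · _) (funext fun p => ?_)).mpr h1
    simp only [Function.comp, hcoef, traceTerm, zero_sub, Int.cast_natCast]
    ring
  · intro n hn
    have : n < 0 := by
      by_contra h
      exact hn ⟨n.toNat, Int.toNat_of_nonneg (by omega)⟩
    rw [hcoef, h.fourierCoef_exp_neg_g_of_neg this, mul_zero, zero_mul, neg_zero]

/-- Apply Wiener–Hopf with P = e^g, M = e^{t k(1/z)} and χ = z^l e^g k(1/z), so that Mχ is the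
derivative symbol shifted by l. Then χQ = z^l k(1/z) has no coefficient of index i ≥ l, as k(0) = 0,
and x_i is a pure tail; the cases needed are i = l and i ≥ N. The tail does not involve t. -/
theorem exists_trace_solution (h : LogParts g k R R₁ A) (t : ℂ) (l : ℕ) :
    ∃ x : ℕ → ℂ,
      (∀ j : ℕ, HasSum (fun i : ℕ =>
        fourierCoef (fun z => exp (g z) * exp (t * k z⁻¹)) ((j : ℤ) - i) * x i)
        (fourierCoef (fun z => exp (g z) * exp (t * k z⁻¹) * k z⁻¹) ((j : ℤ) - l))) ∧
      (∀ i, l ≤ i → HasSum (fun m : ℕ =>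
        fourierCoef (fun z => exp (g z) * k z⁻¹) (-(m + 1) - l) *
          fourierCoef (fun z => exp (-g z)) (i + (m + 1))) (- x i)) := by
  have hzpow : ∀ z : ℂ, R⁻¹ ≤ ‖z‖ → DifferentiableAt ℂ (fun z => z ^ (l : ℤ)) z := fun z h1 =>
    differentiableAt_zpow.2
      (Or.inl (norm_pos_iff.1 ((inv_pos.2 (by linarith [h.one_lt])).trans_le h1)))
  have hχ : IsWiener fun z => z ^ (l : ℤ) * (exp (g z) * k z⁻¹) :=
    .of_annulus h.one_lt fun z h1 h2 => (hzpow z h1).mul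
      ((h.differentiableAt_g h2).cexp.mul (h.differentiableAt_k_inv h1))
  have hPQ : ∀ z, exp (g z) * exp (-g z) = 1 := fun z => by rw [← Complex.exp_add]; simp
  obtain ⟨x, hx, hxs, -⟩ := exists_toeplitz_solution (P := fun z => exp (g z)) (fun z _ => hPQ z)
    h.isWiener_exp_neg_g (h.isWiener_exp_k t) hχ (h.isWiener_exp t)
    (fun n hn => h.fourierCoef_exp_neg_g_of_neg hn) (fun n hn => h.fourierCoef_exp_k_of_pos t hn)
  refine ⟨x, fun j => ?_, fun i hi => ?_⟩
  · rw [← fourierCoef_zpow_mul]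
    convert hx j using 2
    ext z
    ring
  · have h1 := hxs i
    have h2 : fourierCoef (fun z => z ^ (l : ℤ) * (exp (g z) * k z⁻¹) * exp (-g z)) i = 0 := by
      have h3 : (fun z => z ^ (l : ℤ) * (exp (g z) * k z⁻¹) * exp (-g z)) =
          fun z => z ^ (l : ℤ) * k z⁻¹ := by
        ext z
        linear_combination z ^ (l : ℤ) * k z⁻¹ * hPQ z
      rw [h3, fourierCoef_zpow_mul, fourierCoef_comp_inv]
      rcases hi.eq_or_lt with rfl | hi
      · rw [sub_self, neg_zero, fourierCoef_zero_of_disc h.one_lt' h.k_diff, h.k_zero]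
      · exact fourierCoef_of_neg h.one_lt' h.k_diff (by omega)
    rw [h2, zero_sub] at h1
    simpa only [fourierCoef_zpow_mul] using h1

/-- The sum is det T times the trace of T⁻¹T' when T is invertible. The diagonal component is x_l =
∑_{p>l} `traceTerm` p, so summation over l produces the weights p. -/
theorem exists_norm_trace_sub_le (h : LogParts g k R R₁ A) {ρ : ℝ} (hρ : R⁻¹ < ρ) :
    ∃ K, 0 ≤ K ∧ ∀ t : ℝ, |t| ≤ 1 → ∀ N : ℕ,
      ‖∑ l : Fin N, (toep (fourierCoef fun z => exp (g z) * exp (t * k z⁻¹)) N).cramer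
          (fun j => fourierCoef (fun z => exp (g z) * exp (t * k z⁻¹) * k z⁻¹) ((j : ℤ) - l)) l -
        (toep (fourierCoef fun z => exp (g z) * exp (t * k z⁻¹)) N).det * szegoExponent g k‖ ≤
        K * ρ ^ N := by
  have hA := h.nonneg
  have hR0 := h.rate_nonneg
  have hR1 := h.rate_lt_one
  set C := Real.exp (A + A) with hC
  have hC0 : 0 ≤ C := (Real.exp_pos _).le
  set D := Real.exp A * A with hD
  have hD0 : 0 ≤ D := by positivity
  obtain ⟨B, hB0, hB⟩ := exists_norm_adjugate_toep_le hC0 hR0 hR1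
  obtain ⟨K₁, hK₁0, hK₁⟩ := exists_norm_sub_sum_tail_le (mul_nonneg hD0 hC0) hR0 hR1
  -- Degree 4: N columns, each with a Cramer error of order N³.
  obtain ⟨K₂, hK₂0, hK₂⟩ := exists_pow_mul_pow_le hR0 hρ 4
  set E := D * C * (1 - R⁻¹)⁻¹ with hE
  have hE0 : 0 ≤ E := mul_nonneg (mul_nonneg hD0 hC0) (inv_nonneg.2 (by linarith))
  set F := B * C * E * (1 - R⁻¹)⁻¹ with hF
  have hF0 : 0 ≤ F := mul_nonneg (by positivity) (inv_nonneg.2 (by linarith))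
  refine ⟨F * K₂ + B * K₁, by positivity, fun t ht N => ?_⟩
  obtain ⟨hdet, hadj⟩ := hB _ _ _ _ _ (h.wienerHopfData ht) N
  set T := toep (fourierCoef fun z => exp (g z) * exp (t * k z⁻¹)) N with hT
  have hsolve := h.exists_trace_solution t
  choose x hx hxs using hsolve
  have hxle : ∀ l i : ℕ, l ≤ i → ‖x l i‖ ≤ E * R⁻¹ ^ i := fun l i hi => by
    rw [← norm_neg]
    refine norm_toeplitz_solution_sub_le (C := C) (D := D)
      (a := fun n => fourierCoef (fun z => exp (g z) * k z⁻¹) (n - l)) hD0 hR0 hR1 (fun m => ?_)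
      h.norm_fourierCoef_exp_neg_g_le (hxs l i hi)
    exact (h.norm_fourierCoef_exp_mul_k_le _).trans
      (mul_le_of_le_one_right hD0 (pow_le_one₀ hR0 hR1.le))
  have hcr : ∀ l : Fin N, ‖T.cramer (fun j => fourierCoef
      (fun z => exp (g z) * exp (t * k z⁻¹) * k z⁻¹) ((j : ℤ) - l)) l - T.det * x l l‖ ≤
      F * (N ^ 3 * R⁻¹ ^ N) := fun l =>
    norm_cramer_toep_sub_le hC0 hR0 hR1
      (fun n => ((h.wienerHopfData ht).u_le n).trans
        (mul_le_of_le_one_right hC0 (pow_le_one₀ hR0 hR1.le)))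
      hadj (fun j _ => hx l j) (fun i hi => hxle l i (by omega)) l
  have htr : ‖szegoExponent g k - ∑ l : Fin N, x l l‖ ≤ K₁ * R⁻¹ ^ N := by
    refine hK₁ (traceTerm g k) (fun l => x l l) _ (fun p => ?_) (fun l => ?_) h.hasSum_traceTerm N
    · rw [hD]
      exact h.norm_traceTerm_le p
    · have h1 := (hxs l l le_rfl).neg
      rw [neg_neg] at h1
      refine (congrArg (HasSum · _) (funext fun m => ?_)).mpr h1
      rw [traceTerm]
      push_cast
      congr 3 <;> ring
  have hsplit : ∑ l : Fin N, T.cramer (fun j => fourierCoef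
      (fun z => exp (g z) * exp (t * k z⁻¹) * k z⁻¹) ((j : ℤ) - l)) l - T.det * szegoExponent g k =
      ∑ l : Fin N, (T.cramer (fun j => fourierCoef
      (fun z => exp (g z) * exp (t * k z⁻¹) * k z⁻¹) ((j : ℤ) - l)) l - T.det * x l l) -
      T.det * (szegoExponent g k - ∑ l : Fin N, x l l) := by
    rw [Finset.sum_sub_distrib, ← Finset.mul_sum]
    ring
  rw [hsplit]
  have hRρ : R⁻¹ ^ N ≤ ρ ^ N := pow_le_pow_left₀ hR0 hρ.le N
  calc _ ≤ ∑ _l : Fin N, F * (N ^ 3 * R⁻¹ ^ N) + B * (K₁ * R⁻¹ ^ N) := by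
        refine (norm_sub_le _ _).trans (add_le_add (norm_sum_le_of_le _ fun l _ => hcr l) ?_)
        rw [norm_mul]
        exact mul_le_mul hdet htr (norm_nonneg _) hB0
    _ = F * (N ^ 4 * R⁻¹ ^ N) + B * K₁ * R⁻¹ ^ N := by
        rw [Finset.sum_const, Finset.card_univ, Fintype.card_fin, nsmul_eq_mul]
        ring
    _ ≤ F * (K₂ * ρ ^ N) + B * K₁ * ρ ^ N := by
        gcongr F * ?_ + B * K₁ * ?_
        exact hK₂ N
    _ = _ := by ring

theorem hasDerivAt_det_toep (h : LogParts g k R R₁ A) (t : ℝ) (N : ℕ) :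
    HasDerivAt (fun s : ℝ => (toep (fourierCoef fun z => exp (g z) * exp (s * k z⁻¹)) N).det)
      (∑ l : Fin N, (toep (fourierCoef fun z => exp (g z) * exp (t * k z⁻¹)) N).cramer
        (fun j => fourierCoef (fun z => exp (g z) * exp (t * k z⁻¹) * k z⁻¹) ((j : ℤ) - l)) l)
      t := by
  refine hasDerivAt_det (A' := toep (fourierCoef fun z => exp (g z) * exp (t * k z⁻¹) * k z⁻¹) N)
    fun i j => ?_
  have hg : ContinuousOn g (sphere 0 1) :=
    continuousOn_unitSphere_of_annulus h.one_lt fun _ _ h2 => h.differentiableAt_g h2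
  have hk : ContinuousOn (fun z => k z⁻¹) (sphere 0 1) :=
    continuousOn_unitSphere_of_annulus h.one_lt fun _ h1 _ => h.differentiableAt_k_inv h1
  simpa only [toep_apply, Complex.exp_add] using
    hasDerivAt_fourierCoef_exp hg hk ((i : ℤ) - j) t

/-- The strong Szegő limit theorem with an exponentially small error. -/
theorem exists_norm_det_sub_le (h : LogParts g k R R₁ A) {ρ : ℝ} (hρ : R⁻¹ < ρ) :
    ∃ K, 0 ≤ K ∧ ∀ N : ℕ,
      ‖(toep (fourierCoef fun z => exp (g z) * exp (k z⁻¹)) N).det - exp (szegoExponent g k)‖ ≤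
        K * ρ ^ N := by
  obtain ⟨K, hK0, hK⟩ := h.exists_norm_trace_sub_le hρ
  have hρ0 : 0 ≤ ρ := h.rate_nonneg.trans hρ.le
  set S := szegoExponent g k with hS
  refine ⟨Real.exp ‖S‖ * (Real.exp ‖S‖ * K), by positivity, fun N => ?_⟩
  set d : ℝ → ℂ := fun s => (toep (fourierCoef fun z => exp (g z) * exp (s * k z⁻¹)) N).det with hd
  have hd0 : d 0 = 1 := by
    simp only [hd, Complex.ofReal_zero, zero_mul, Complex.exp_zero, mul_one]
    exact det_toep_of_neg (fun n hn => fourierCoef_of_neg h.one_lt' h.g_diff.cexp hn)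
      (h.wienerHopfData (t := 0) (by simp)).p_zero N
  have hd1 : d 1 = (toep (fourierCoef fun z => exp (g z) * exp (k z⁻¹)) N).det := by
    simp only [hd, Complex.ofReal_one, one_mul]
  have hexp : ∀ t : ℝ, HasDerivAt (fun s : ℝ => exp (-(s * S))) (exp (-(t * S)) * -S) t := fun t =>
    by simpa using (((Complex.ofRealCLM.hasDerivAt (x := t)).mul_const S).neg).cexp
  -- The integrating factor e^{-tS} turns d' = S d + O(ρ^N) into a derivative of size O(ρ^N); the
  -- mean value inequality on [0, 1] then compares e^{-S} d(1) with d(0) = 1.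
  have hmv := norm_image_sub_le_of_norm_deriv_le_segment_01'
    (f := fun s : ℝ => exp (-(s * S)) * d s) (C := Real.exp ‖S‖ * (K * ρ ^ N))
    (fun t _ => ((hexp t).mul (h.hasDerivAt_det_toep t N)).hasDerivWithinAt) fun t ht => by
      have ht' : |t| ≤ 1 := abs_le.2 ⟨by linarith [ht.1], ht.2.le⟩
      have h1 : ∀ a b c : ℂ, a * -S * b + a * c = a * (c - b * S) := fun a b c => by ring
      rw [h1, norm_mul]
      refine mul_le_mul (norm_exp_le ?_) (hK t ht' N) (norm_nonneg _) (Real.exp_pos _).le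
      rw [norm_neg, norm_mul, Complex.norm_real, Real.norm_eq_abs]
      exact mul_le_of_le_one_left (norm_nonneg _) ht'
  simp only [hd0, hd1, Complex.ofReal_zero, Complex.ofReal_one, zero_mul, neg_zero, one_mul,
    Complex.exp_zero, mul_one] at hmv
  have h2 : ∀ a : ℂ, a - exp S = exp S * (exp (-S) * a - 1) := fun a => by
    rw [mul_sub, ← mul_assoc, ← Complex.exp_add, add_neg_cancel, Complex.exp_zero, one_mul, mul_one]
  rw [h2, norm_mul]
  calc _ ≤ Real.exp ‖S‖ * (Real.exp ‖S‖ * (K * ρ ^ N)) :=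
        mul_le_mul (norm_exp_le le_rfl) hmv (norm_nonneg _) (Real.exp_pos _).le
    _ = _ := by ring

/-- Asymptotics of the determinant of a Toeplitz matrix whose first column is replaced. -/
theorem exists_norm_cramer_sub_le (h : LogParts g k R R₁ A) {ρ : ℝ} (hρ : R⁻¹ < ρ) {χ : ℂ → ℂ}
    (hχ : ∀ z : ℂ, R⁻¹ ≤ ‖z‖ → ‖z‖ ≤ R → DifferentiableAt ℂ χ z) :
    ∃ K, 0 ≤ K ∧ ∀ (N : ℕ) (hN : 0 < N),
      ‖(toep (fourierCoef fun z => exp (g z) * exp (k z⁻¹)) N).cramer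
          (fun j => fourierCoef (fun z => exp (k z⁻¹) * χ z) (j : ℕ)) ⟨0, hN⟩ -
        exp (szegoExponent g k) * fourierCoef χ 0‖ ≤ K * ρ ^ N := by
  have hR0 := h.rate_nonneg
  have hR1 := h.rate_lt_one
  set C := Real.exp (A + A) with hC
  have hC0 : 0 ≤ C := (Real.exp_pos _).le
  obtain ⟨K₀, hK₀0, hK₀⟩ := h.exists_norm_det_sub_le hρ
  obtain ⟨B, hB0, hB⟩ := exists_norm_adjugate_toep_le hC0 hR0 hR1
  obtain ⟨K₁, hK₁0, hK₁⟩ := exists_pow_mul_pow_le hR0 hρ 3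
  obtain ⟨D, hD0, hD⟩ := exists_decay_of_annulus h.one_lt hχ
  obtain ⟨D', hD'0, hD'⟩ := exists_decay_of_annulus (f := fun z => χ z * exp (-g z)) h.one_lt
    fun z h1 h2 => (hχ z h1 h2).mul (h.differentiableAt_g h2).neg.cexp
  have hW := h.wienerHopfData (t := 1) (by simp)
  have hM := h.isWiener_exp_k 1
  have hPM := h.isWiener_exp 1
  have hpos := fun n hn => h.fourierCoef_exp_k_of_pos 1 (n := n) hn
  simp only [Complex.ofReal_one, one_mul] at hW hM hPM hpos
  have hPQ : ∀ z, exp (g z) * exp (-g z) = 1 := fun z => by rw [← Complex.exp_add]; simp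
  obtain ⟨x, hx, hxs, hx0⟩ := exists_toeplitz_solution (P := fun z => exp (g z)) (fun z _ => hPQ z)
    h.isWiener_exp_neg_g hM (.of_annulus h.one_lt hχ) hPM
    (fun n hn => h.fourierCoef_exp_neg_g_of_neg hn) hpos
  have hQ0 : fourierCoef (fun z => exp (-g z)) 0 = 1 := by
    rw [fourierCoef_zero_of_disc (f := fun z => exp (-g z)) h.one_lt' h.g_diff.neg.cexp]
    simp [h.g_zero]
  -- Because g(0) = 0, the component of index 0 is exactly χ_0.
  rw [hQ0, mul_one] at hx0
  set E := D' + D * C * (1 - R⁻¹)⁻¹ with hE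
  have hE0 : 0 ≤ E := add_nonneg hD'0 (mul_nonneg (by positivity) (inv_nonneg.2 (by linarith)))
  have hxle : ∀ i : ℕ, ‖x i‖ ≤ E * R⁻¹ ^ i := fun i => by
    have h1 := norm_toeplitz_solution_sub_le (C := C) (D := D) (a := fourierCoef χ) hD0 hR0 hR1
      (fun m => (hD _).trans (mul_le_of_le_one_right hD0 (pow_le_one₀ hR0 hR1.le)))
      h.norm_fourierCoef_exp_neg_g_le (hxs i)
    have h2 := hD' i
    rw [Int.natAbs_natCast] at h2
    have h3 := norm_sub_norm_le (x i) (fourierCoef (fun z => χ z * exp (-g z)) i)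
    rw [norm_sub_rev] at h3
    rw [hE, add_mul]
    linarith
  set F := B * C * E * (1 - R⁻¹)⁻¹ with hF
  have hF0 : 0 ≤ F := mul_nonneg (by positivity) (inv_nonneg.2 (by linarith))
  refine ⟨F * K₁ + K₀ * ‖fourierCoef χ 0‖, by positivity, fun N hN => ?_⟩
  have hadj := (hB _ _ _ _ _ hW N).2
  have h1 := norm_cramer_toep_sub_le hC0 hR0 hR1
      (fun n => (hW.u_le n).trans (mul_le_of_le_one_right hC0 (pow_le_one₀ hR0 hR1.le)))
      hadj (fun j _ => hx j) (fun i _ => hxle i) ⟨0, hN⟩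
  set T := toep (fourierCoef fun z => exp (g z) * exp (k z⁻¹)) N with hT
  have h2 : ∀ a b c d e : ℂ, a - b * c = (a - d * c) + (d - b) * c := fun a b c d _ => by ring
  rw [h2 _ _ _ T.det 0]
  simp only [hx0] at h1
  calc _ ≤ F * (N ^ 3 * R⁻¹ ^ N) + K₀ * ρ ^ N * ‖fourierCoef χ 0‖ := by
        refine (norm_add_le _ _).trans (add_le_add h1 ?_)
        rw [norm_mul]
        exact mul_le_mul_of_nonneg_right (hK₀ N) (norm_nonneg _)
    _ ≤ F * (K₁ * ρ ^ N) + K₀ * ρ ^ N * ‖fourierCoef χ 0‖ := by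
        gcongr F * ?_ + _
        exact hK₁ N
    _ = _ := by ring

end LogParts

/-! ### Logarithms on the unit circle -/

/-- Radial projection to the circle moves z by | |z| - 1 |, so the annulus lies in a δ-thickening.
-/
theorem exists_annulus_subset {U : Set ℂ} (hU : IsOpen U) (hS : sphere (0 : ℂ) 1 ⊆ U) :
    ∃ R : ℝ, 1 < R ∧ ∀ z : ℂ, R⁻¹ ≤ ‖z‖ → ‖z‖ ≤ R → z ∈ U := by
  obtain ⟨δ, hδ, hsub⟩ := (isCompact_sphere (0 : ℂ) 1).exists_cthickening_subset_open hU hS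
  refine ⟨1 + δ, by linarith, fun z h1 h2 => hsub ?_⟩
  have hz : 0 < ‖z‖ := (inv_pos.2 (by linarith)).trans_le h1
  have hz' : (‖z‖ : ℂ) ≠ 0 := Complex.ofReal_ne_zero.2 hz.ne'
  refine mem_cthickening_of_dist_le z (z / ‖z‖) δ _ (by simp [hz.ne']) ?_
  have h3 : z - z / ‖z‖ = z / ‖z‖ * ((‖z‖ - 1 : ℝ) : ℂ) := by
    push_cast
    field_simp
  rw [dist_eq_norm, h3, norm_mul, norm_div, Complex.norm_real, norm_norm, div_self hz.ne', one_mul,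
    Complex.norm_real, Real.norm_eq_abs, abs_le]
  refine ⟨?_, by linarith⟩
  -- The inner radius is also within δ of 1, as (1 - δ)(1 + δ) ≤ 1.
  have h4 : 1 - δ ≤ (1 + δ)⁻¹ := by
    rw [← one_div, le_div_iff₀ (by linarith)]
    nlinarith
  linarith

theorem hasDerivAt_circle_of_eqOn {f φ : ℂ → ℂ} (hf : AnalyticOnNhd ℂ f (sphere 0 1))
    (hfφ : Set.EqOn f φ (sphere 0 1)) (t : ℝ) :
    HasDerivAt (fun s : ℝ => φ (circleMap 0 1 s))
      (circleMap 0 1 t * Complex.I * deriv f (circleMap 0 1 t)) t := by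
  have h := ((hf _ (circleMap_mem_unitSphere t)).differentiableAt.hasDerivAt).comp t
    (hasDerivAt_circleMap 0 1 t)
  have he : (fun s : ℝ => φ (circleMap 0 1 s)) = f ∘ circleMap 0 1 :=
    funext fun s => (hfφ (circleMap_mem_unitSphere s)).symm
  rw [he]
  exact h.congr_deriv (mul_comm _ _)

/-- The logarithmic derivative of a symbol with respect to the angle, divided by `i`. -/
noncomputable def circleLogDeriv (f : ℂ → ℂ) (z : ℂ) : ℂ := z * deriv f z / f z

theorem continuousOn_circleLogDeriv {f : ℂ → ℂ} (hf : AnalyticOnNhd ℂ f (sphere 0 1))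
    (h0 : ∀ z ∈ sphere (0 : ℂ) 1, f z ≠ 0) : ContinuousOn (circleLogDeriv f) (sphere 0 1) :=
  (continuousOn_id.mul hf.deriv.continuousOn).div hf.continuousOn h0

/-- Integrate the logarithmic derivative along the angle; winding number zero makes the primitive
periodic, so it descends to the circle. -/
theorem exists_isContinuousLog {φ : ℂ → ℂ} (hφ : IsSzegoType φ) : ∃ L, IsContinuousLog φ L := by
  obtain ⟨f, hf, hfφ⟩ := hφ.continuation
  have hf0 : ∀ z ∈ sphere (0 : ℂ) 1, f z ≠ 0 := fun z hz => hfφ hz ▸ hφ.ne_zero z hz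
  set F : ℝ → ℂ := fun t => Complex.I * circleLogDeriv f (circleMap 0 1 t) with hF
  have hFc : Continuous F :=
    continuous_const.mul (continuous_comp_circleMap (continuousOn_circleLogDeriv hf hf0))
  have hFp : Function.Periodic F (2 * π) := fun t => by
    simp only [hF, periodic_circleMap 0 1 t]
  have hF0 : ∫ t in (0 : ℝ)..(2 * π), F t = 0 := by
    have hw := hφ.winding
    rw [windingNumber, mul_eq_zero] at hw
    rw [← hw.resolve_left (by simp [Real.pi_ne_zero])]
    refine intervalIntegral.integral_congr fun t _ => ?_
    simp only [hF, circleLogDeriv, (hasDerivAt_circle_of_eqOn hf hfφ t).deriv,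
      ← hfφ (circleMap_mem_unitSphere t)]
    ring
  set l : ℝ → ℂ := fun t => (∫ s in (0 : ℝ)..t, F s) + Complex.log (φ 1) with hl
  have hlp : Function.Periodic l (2 * π) := fun t => by
    simp only [hl]
    rw [← intervalIntegral.integral_add_adjacent_intervals (hFc.intervalIntegrable 0 t)
      (hFc.intervalIntegrable t (t + 2 * π)), hFp.intervalIntegral_add_eq t 0, zero_add, hF0,
      add_zero]
  have hld : ∀ t, HasDerivAt l (F t) t := fun t =>
    ((intervalIntegral.integral_hasDerivAt_right (hFc.intervalIntegrable 0 t)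
      (hFc.stronglyMeasurableAtFilter _ _) hFc.continuousAt).add_const _)
  have hlc : Continuous l := continuous_iff_continuousAt.2 fun t => (hld t).continuousAt
  have hexp : ∀ t, Complex.exp (l t) = φ (circleMap 0 1 t) := fun t => by
    have hd : ∀ s, HasDerivAt (fun s => φ (circleMap 0 1 s) * Complex.exp (-l s)) 0 s := fun s => by
      refine ((hasDerivAt_circle_of_eqOn hf hfφ s).mul (hld s).neg.cexp).congr_deriv ?_
      have := hf0 _ (circleMap_mem_unitSphere s)
      simp only [hF, circleLogDeriv, ← hfφ (circleMap_mem_unitSphere s)]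
      field_simp
      ring
    have hconst := is_const_of_deriv_eq_zero (fun s => (hd s).differentiableAt)
      (fun s => (hd s).deriv) t 0
    have h1 : φ 1 ≠ 0 := hφ.ne_zero 1 (by simp)
    simp only [hl, intervalIntegral.integral_same, zero_add, circleMap_zero, Complex.ofReal_one,
      Complex.ofReal_zero, zero_mul, Complex.exp_zero, mul_one, Complex.exp_neg,
      Complex.exp_log h1, mul_inv_cancel₀ h1] at hconst
    rw [circleMap_zero, Complex.ofReal_one]
    exact (eq_of_mul_inv_eq_one hconst).symm
  -- As a map to `Real.Angle` the argument is continuous away from 0, with no branch cut.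
  obtain ⟨lf, hlfc, hlf⟩ : ∃ lf : Real.Angle → ℂ, Continuous lf ∧ ∀ t : ℝ, lf t = l t :=
    ⟨hlp.lift, continuous_coinduced_dom.2 hlc, fun _ => rfl⟩
  refine ⟨fun z => lf (Complex.arg z), fun z hz => ?_, fun z hz => ?_⟩
  · exact (hlfc.continuousAt.comp
      (Complex.continuousAt_arg_coe_angle (ne_zero_of_mem_unitSphere hz))).continuousWithinAt
  · simp only [hlf]
    rw [hexp, circleMap_zero, ← mem_sphere_zero_iff_norm.1 hz, Complex.norm_mul_exp_arg_mul_I]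

/-- By continuity L moves by less than π near t, so there it equals L at t plus the principal
logarithm of a quotient of values of φ. -/
theorem IsContinuousLog.hasDerivAt {f φ L : ℂ → ℂ} (hL : IsContinuousLog φ L)
    (hf : AnalyticOnNhd ℂ f (sphere 0 1)) (hfφ : Set.EqOn f φ (sphere 0 1)) (t : ℝ) :
    HasDerivAt (fun s : ℝ => L (circleMap 0 1 s))
      (Complex.I * circleLogDeriv f (circleMap 0 1 t)) t := by
  have hLc := continuous_comp_circleMap hL.1
  have hφ0 : φ (circleMap 0 1 t) ≠ 0 := by
    rw [← hL.2 _ (circleMap_mem_unitSphere t)]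
    exact Complex.exp_ne_zero _
  have hd : HasDerivAt (fun s : ℝ => L (circleMap 0 1 t) +
      Complex.log (φ (circleMap 0 1 s) / φ (circleMap 0 1 t)))
      (Complex.I * circleLogDeriv f (circleMap 0 1 t)) t := by
    have h1 := (hasDerivAt_circle_of_eqOn hf hfφ t).div_const (φ (circleMap 0 1 t))
    have h2 := h1.clog_real (by rw [div_self hφ0]; exact Complex.one_mem_slitPlane)
    refine (h2.const_add _).congr_deriv ?_
    rw [div_self hφ0, div_one, circleLogDeriv, hfφ (circleMap_mem_unitSphere t)]
    ring
  refine hd.congr_of_eventuallyEq ?_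
  have hnear : ∀ᶠ s in nhds t, ‖L (circleMap 0 1 s) - L (circleMap 0 1 t)‖ < π := by
    have := (hLc.sub continuous_const).norm.tendsto t (f := fun s : ℝ =>
      ‖L (circleMap 0 1 s) - L (circleMap 0 1 t)‖)
    exact this.eventually_lt_const (by simp [Real.pi_pos])
  filter_upwards [hnear] with s hs
  have him := abs_lt.1 ((Complex.abs_im_le_norm _).trans_lt hs)
  rw [← hL.2 _ (circleMap_mem_unitSphere s), ← hL.2 _ (circleMap_mem_unitSphere t),
    ← Complex.exp_sub, Complex.log_exp him.1 him.2.le]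
  ring

/-- The logarithm itself is not continued: n L_n is a coefficient of z f'/f, which is analytic in
the annulus, and |n| ≥ 1 unless n = 0. -/
theorem IsContinuousLog.exists_decay {f φ L : ℂ → ℂ} (hL : IsContinuousLog φ L)
    (hf : AnalyticOnNhd ℂ f (sphere 0 1)) (hfφ : Set.EqOn f φ (sphere 0 1)) {R : ℝ} (hR : 1 < R)
    (hfR : ∀ z : ℂ, R⁻¹ ≤ ‖z‖ → ‖z‖ ≤ R → AnalyticAt ℂ f z ∧ f z ≠ 0) :
    ∃ C, 0 ≤ C ∧ ∀ n, ‖fourierCoef L n‖ ≤ C * R⁻¹ ^ n.natAbs := by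
  have hd : ∀ z : ℂ, R⁻¹ ≤ ‖z‖ → ‖z‖ ≤ R → DifferentiableAt ℂ (circleLogDeriv f) z :=
    fun z h1 h2 => ((differentiableAt_id.mul (hfR z h1 h2).1.deriv.differentiableAt).div
      (hfR z h1 h2).1.differentiableAt (hfR z h1 h2).2)
  obtain ⟨C, hC0, hC⟩ := exists_decay_of_annulus hR hd
  refine ⟨C + ‖fourierCoef L 0‖, by positivity, fun n => ?_⟩
  rcases eq_or_ne n 0 with rfl | hn
  · simpa using hC0
  · have h1 := hC n
    have hpos : 0 ≤ ‖fourierCoef L 0‖ * R⁻¹ ^ n.natAbs := by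
      have : 0 < R := by linarith
      positivity
    rw [fourierCoef_deriv (continuousOn_unitSphere_of_annulus hR hd)
      (fun t => hL.hasDerivAt hf hfφ t), norm_mul] at h1
    have h2 : (1 : ℝ) ≤ ‖(n : ℂ)‖ := by
      rw [Complex.norm_intCast]
      exact_mod_cast Int.one_le_abs hn
    nlinarith [norm_nonneg (fourierCoef L n)]

theorem differentiableOn_tsum_pow_succ {a : ℕ → ℂ} {C R : ℝ} (hR : 1 < R)
    (ha : ∀ n, ‖a n‖ ≤ C * R⁻¹ ^ n) :
    DifferentiableOn ℂ (fun z => ∑' n : ℕ, a n * z ^ (n + 1)) (ball 0 R) := by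
  have hR0 : 0 < R := one_pos.trans hR
  intro z hz
  rw [mem_ball_zero_iff] at hz
  obtain ⟨r, hzr, hrR⟩ := exists_between hz
  have hr0 : 0 ≤ r := (norm_nonneg z).trans hzr.le
  have hC : 0 ≤ C := by simpa using (norm_nonneg _).trans (ha 0)
  have hs : Summable fun n : ℕ => C * r * (R⁻¹ * r) ^ n :=
    (summable_geometric_of_lt_one (by positivity)
      (by rw [inv_mul_eq_div]; exact (div_lt_one hR0).2 hrR)).mul_left _
  have h := Complex.differentiableOn_tsum_of_summable_norm hs
    (F := fun n z => a n * z ^ (n + 1)) (U := ball 0 r)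
    (fun n => ((differentiable_id.pow _).const_mul _).differentiableOn) isOpen_ball
    fun n w hw => by
      rw [mem_ball_zero_iff] at hw
      rw [norm_mul, norm_pow]
      calc ‖a n‖ * ‖w‖ ^ (n + 1) ≤ C * R⁻¹ ^ n * r ^ (n + 1) := by
            gcongr
            exact ha n
        _ = _ := by ring
  exact (h.differentiableAt (isOpen_ball.mem_nhds (by simpa using hzr))).differentiableWithinAt

theorem IsWiener.eq_add_tsum {L : ℂ → ℂ} (hL : IsWiener L) {z : ℂ} (hz : z ∈ sphere (0 : ℂ) 1) :
    L z = fourierCoef L 0 + ∑' n : ℕ, fourierCoef L (n + 1) * z ^ (n + 1) +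
      ∑' n : ℕ, fourierCoef L (-(n + 1)) * z⁻¹ ^ (n + 1) := by
  have hs := hL.hasSum hz
  have hinj : Function.Injective fun m : ℕ => -((m : ℤ) + 1) := fun a b hab => by
    simpa using hab
  have hs1 : Summable fun n : ℕ => fourierCoef L n * z ^ (n : ℤ) :=
    hs.summable.comp_injective Nat.cast_injective
  have hs2 : Summable fun n : ℕ => fourierCoef L (-((n : ℤ) + 1)) * z ^ (-((n : ℤ) + 1)) :=
    hs.summable.comp_injective hinj
  have h1 := hs1.tsum_eq_zero_add
  have h2 : ∀ n : ℕ, fourierCoef L ((n + 1 : ℕ) : ℤ) * z ^ ((n + 1 : ℕ) : ℤ) =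
      fourierCoef L (n + 1) * z ^ (n + 1) := fun n => by
    rw [zpow_natCast, Nat.cast_add, Nat.cast_one]
  have h3 : ∀ n : ℕ, fourierCoef L (-((n : ℤ) + 1)) * z ^ (-((n : ℤ) + 1)) =
      fourierCoef L (-(n + 1)) * z⁻¹ ^ (n + 1) := fun n => by
    rw [zpow_neg, inv_pow, ← zpow_natCast, Nat.cast_add, Nat.cast_one]
  rw [tsum_congr h2, Nat.cast_zero, zpow_zero, mul_one] at h1
  have h4 := tsum_of_nat_of_neg_add_one (f := fun k : ℤ => fourierCoef L k * z ^ k) hs1 hs2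
  rw [hs.tsum_eq, h1, tsum_congr h3] at h4
  exact h4

/-- The two halves of the Fourier series of L without its mean are power series in z and 1/z. They
converge for radius R₁; the smaller R makes them bounded. -/
theorem exists_logParts {L : ℂ → ℂ} (hLc : ContinuousOn L (sphere 0 1)) {C R R₁ : ℝ} (hR : 1 < R)
    (hR₁ : R < R₁) (hL : ∀ n, ‖fourierCoef L n‖ ≤ C * R₁⁻¹ ^ n.natAbs) :
    ∃ g k A, LogParts g k R R₁ A ∧
      ∀ z ∈ sphere (0 : ℂ) 1, L z = fourierCoef L 0 + g z + k z⁻¹ := by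
  have hR₁1 : 1 < R₁ := hR.trans hR₁
  have hr0 : 0 ≤ R₁⁻¹ := inv_nonneg.2 (by linarith)
  have hr1 : R₁⁻¹ < 1 := inv_lt_one_of_one_lt₀ hR₁1
  have hC : 0 ≤ C := by simpa using (norm_nonneg _).trans (hL 0)
  have hle : ∀ n : ℕ, C * R₁⁻¹ ^ (n + 1) ≤ C * R₁⁻¹ ^ n := fun n =>
    mul_le_mul_of_nonneg_left (pow_le_pow_of_le_one hr0 hr1.le (Nat.le_succ n)) hC
  have hg : ∀ n : ℕ, ‖fourierCoef L (n + 1)‖ ≤ C * R₁⁻¹ ^ n := fun n => by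
    refine (hL _).trans ?_
    rw [show ((n : ℤ) + 1).natAbs = n + 1 by omega]
    exact hle n
  have hk : ∀ n : ℕ, ‖fourierCoef L (-(n + 1))‖ ≤ C * R₁⁻¹ ^ n := fun n => by
    refine (hL _).trans ?_
    rw [show (-((n : ℤ) + 1)).natAbs = n + 1 by omega]
    exact hle n
  have hgd := differentiableOn_tsum_pow_succ hR₁1 hg
  have hkd := differentiableOn_tsum_pow_succ hR₁1 hk
  set g : ℂ → ℂ := fun z => ∑' n : ℕ, fourierCoef L (n + 1) * z ^ (n + 1) with hgdef
  set k : ℂ → ℂ := fun z => ∑' n : ℕ, fourierCoef L (-(n + 1)) * z ^ (n + 1) with hkdef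
  obtain ⟨A, hA⟩ := (isCompact_closedBall (0 : ℂ) R).exists_bound_of_continuousOn
    (hgd.continuousOn.mono (closedBall_subset_ball hR₁))
  obtain ⟨B, hB⟩ := (isCompact_closedBall (0 : ℂ) R).exists_bound_of_continuousOn
    (hkd.continuousOn.mono (closedBall_subset_ball hR₁))
  refine ⟨g, k, max A B, ⟨hR, hR₁, hgd, hkd, by simp [hgdef], by simp [hkdef],
    fun z hz => (hA z hz).trans (le_max_left _ _), fun z hz => (hB z hz).trans (le_max_right _ _)⟩,
    fun z hz => ?_⟩
  exact (IsWiener.of_decay hLc hr0 hr1 hL).eq_add_tsum hz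

/-! ### The constants in terms of the analytic parts of the logarithm -/

theorem fourierCoef_const {a : ℂ} {n : ℤ} (hn : n ≠ 0) : fourierCoef (fun _ => a) n = 0 := by
  simpa [fourierCoef_one, hn] using fourierCoef_const_mul a (fun _ => 1) n

theorem continuousOn_div_sub {c : ℂ} (hc : ‖c‖ ≠ 1) :
    ContinuousOn (fun z : ℂ => z / (z - c)) (sphere 0 1) :=
  continuousOn_id.div (continuousOn_id.sub continuousOn_const) fun z hz h0 => hc (by
    rw [← sub_eq_zero.1 h0]
    exact mem_sphere_zero_iff_norm.1 hz)

theorem continuousOn_comp_inv {F : ℂ → ℂ} (hF : ContinuousOn F (sphere 0 1)) :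
    ContinuousOn (fun z => F z⁻¹) (sphere 0 1) :=
  hF.comp (continuousOn_inv₀.mono fun _ hz => ne_zero_of_mem_unitSphere hz)
    fun _ hz => inv_mem_unitSphere hz

section Disc

variable {F : ℂ → ℂ} {R : ℝ}

/-- Under z ↦ 1/z the factor z/(z - c) becomes 1/(1 - cz) = 1 - z/(z - c⁻¹). -/
theorem fourierCoef_div_sub_mul_comp_inv (hR : 1 < R) (hF : DifferentiableOn ℂ F (ball 0 R))
    {c : ℂ} (hc0 : c ≠ 0) (hc : ‖c‖ ≠ 1) :
    fourierCoef (fun z => z / (z - c) * F z⁻¹) 0 =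
      F 0 - fourierCoef (fun z => z / (z - c⁻¹) * F z) 0 := by
  have hFc := continuousOn_unitSphere_of_disc hR hF
  have hc' : ‖c⁻¹‖ ≠ 1 := by rwa [norm_inv, Ne, inv_eq_one]
  have h1 := fourierCoef_comp_inv (fun z => z⁻¹ / (z⁻¹ - c) * F z) 0
  simp only [inv_inv, neg_zero] at h1
  rw [h1, ← fourierCoef_zero_of_disc hR hF,
    ← fourierCoef_sub hFc ((continuousOn_div_sub hc').fun_mul hFc)]
  refine fourierCoef_congr (fun z hz => ?_) 0
  have hz0 := ne_zero_of_mem_unitSphere hz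
  have hz1 := mem_sphere_zero_iff_norm.1 hz
  have h2 : 1 - z * c ≠ 0 := fun h => hc (by
    have h3 : ‖z * c‖ = 1 := by rw [← sub_eq_zero.1 h, norm_one]
    rwa [norm_mul, hz1, one_mul] at h3)
  have h4 : z⁻¹ - c = (1 - z * c) / z := by field_simp
  have h5 : z - c⁻¹ = -(1 - z * c) / c := by field_simp; ring
  rw [h4, h5]
  field_simp
  ring

/-- F has no negative frequencies: the a₁ term drops out, b₀ picks the linear coefficient, and only
poles inside the disc contribute. -/
theorem fourierCoef_ratq₁_mul (hR : 1 < R) (hF : DifferentiableOn ℂ F (ball 0 R)) {m : ℕ}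
    (a₀ a₁ b₀ : ℂ) (b : Fin m → ℂ) {c : Fin m → ℂ} (hc₁ : ∀ j, ‖c j‖ ≠ 1) :
    fourierCoef (fun z => ratq₁ a₀ a₁ b₀ b c z * F z) 0 =
      a₀ * F 0 + b₀ * deriv F 0 + ∑ j, if ‖c j‖ < 1 then b j * F (c j) else 0 := by
  have hFc := continuousOn_unitSphere_of_disc hR hF
  have hz : ∀ n : ℤ, ContinuousOn (fun z => z ^ n * F z) (sphere 0 1) := fun n =>
    (continuousOn_zpow_unitSphere n).fun_mul hFc
  have hd : ∀ j, ContinuousOn (fun z => z / (z - c j) * F z) (sphere 0 1) := fun j =>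
    (continuousOn_div_sub (hc₁ j)).fun_mul hFc
  have h1 : fourierCoef (fun z => ratq₁ a₀ a₁ b₀ b c z * F z) 0 =
      fourierCoef (fun z => a₀ * F z + a₁ * (z ^ (1 : ℤ) * F z) + b₀ * (z ^ (-1 : ℤ) * F z) +
        ∑ j, b j * (z / (z - c j) * F z)) 0 := by
    congr 1
    ext z
    simp only [ratq₁, add_mul, Finset.sum_mul, zpow_one, zpow_neg]
    congr 1
    · ring
    · exact Finset.sum_congr rfl fun j _ => by ring
  rw [h1, fourierCoef_add (((continuousOn_const.fun_mul hFc).fun_add (continuousOn_const.fun_mul (hz 1))).fun_add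
      (continuousOn_const.fun_mul (hz (-1))))
      (continuousOn_finsetSum _ fun j _ => continuousOn_const.fun_mul (hd j)),
    fourierCoef_add ((continuousOn_const.fun_mul hFc).fun_add (continuousOn_const.fun_mul (hz 1)))
      (continuousOn_const.fun_mul (hz (-1))),
    fourierCoef_add (continuousOn_const.fun_mul hFc) (continuousOn_const.fun_mul (hz 1)),
    fourierCoef_finset_sum _ fun j _ => continuousOn_const.fun_mul (hd j)]
  simp only [fourierCoef_const_mul, fourierCoef_zpow_mul]
  rw [fourierCoef_zero_of_disc hR hF, fourierCoef_of_neg hR hF (by norm_num), sub_neg_eq_add,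
    zero_add, fourierCoef_one_of_disc hR hF, mul_zero, add_zero]
  congr 1
  refine Finset.sum_congr rfl fun j _ => ?_
  split_ifs with hj
  · rw [fourierCoef_div_sub_mul hR hF hj]
  · rw [fourierCoef_div_sub_mul_of_one_lt hR hF (lt_of_le_of_ne (not_lt.1 hj) (hc₁ j).symm),
      mul_zero]

theorem fourierCoef_ratq₂_mul (hR : 1 < R) (hF : DifferentiableOn ℂ F (ball 0 R)) {m : ℕ}
    (ah₀ ah₁ bh₀ : ℂ) (bh : Fin m → ℂ) {c : Fin m → ℂ} (hc₀ : ∀ j, c j ≠ 0)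
    (hc₁ : ∀ j, ‖c j‖ ≠ 1) :
    fourierCoef (fun z => ratq₂ ah₀ ah₁ bh₀ bh c z * F z⁻¹) 0 =
      ah₀ * F 0 + ah₁ * deriv F 0 -
        ∑ j, if 1 < ‖c j‖ then bh j / c j * F (c j)⁻¹ else 0 := by
  have hFc := continuousOn_comp_inv (continuousOn_unitSphere_of_disc hR hF)
  have hz : ∀ n : ℤ, ContinuousOn (fun z => z ^ n * F z⁻¹) (sphere 0 1) := fun n =>
    (continuousOn_zpow_unitSphere n).fun_mul hFc
  have hd : ∀ j, ContinuousOn (fun z => z / (z - c j) * F z⁻¹) (sphere 0 1) := fun j =>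
    (continuousOn_div_sub (hc₁ j)).fun_mul hFc
  have h1 : fourierCoef (fun z => ratq₂ ah₀ ah₁ bh₀ bh c z * F z⁻¹) 0 =
      fourierCoef (fun z => ah₀ * F z⁻¹ + ah₁ * (z ^ (1 : ℤ) * F z⁻¹) +
        -- The poles are rewritten by 1/(z - c) = (z/(z - c) - 1)/c to reach the form of the
        -- preceding lemmas.
        bh₀ * (z ^ (-1 : ℤ) * F z⁻¹) +
        ∑ j, bh j / c j * (z / (z - c j) * F z⁻¹ - F z⁻¹)) 0 := by
    refine fourierCoef_congr (fun z hz => ?_) 0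
    simp only [ratq₂, add_mul, Finset.sum_mul, zpow_one, zpow_neg]
    congr 1
    · ring
    · refine Finset.sum_congr rfl fun j _ => ?_
      have h2 : z - c j ≠ 0 := fun h => hc₁ j (by
        rw [← sub_eq_zero.1 h]
        exact mem_sphere_zero_iff_norm.1 hz)
      have h3 := hc₀ j
      field_simp
      ring
  rw [h1, fourierCoef_add (((continuousOn_const.fun_mul hFc).fun_add (continuousOn_const.fun_mul (hz 1))).fun_add
      (continuousOn_const.fun_mul (hz (-1))))
      (continuousOn_finsetSum _ fun j _ => continuousOn_const.fun_mul ((hd j).fun_sub hFc)),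
    fourierCoef_add ((continuousOn_const.fun_mul hFc).fun_add (continuousOn_const.fun_mul (hz 1)))
      (continuousOn_const.fun_mul (hz (-1))),
    fourierCoef_add (continuousOn_const.fun_mul hFc) (continuousOn_const.fun_mul (hz 1)),
    fourierCoef_finset_sum _ fun j _ => continuousOn_const.fun_mul ((hd j).fun_sub hFc)]
  simp only [fourierCoef_const_mul, fourierCoef_zpow_mul, fourierCoef_sub (hd _) hFc,
    fourierCoef_comp_inv F]
  rw [neg_zero, fourierCoef_zero_of_disc hR hF, fourierCoef_of_neg hR hF (n := -(0 - -1))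
    (by norm_num), show -((0 : ℤ) - 1) = 1 by norm_num, fourierCoef_one_of_disc hR hF, mul_zero,
    add_zero, sub_eq_add_neg, ← Finset.sum_neg_distrib]
  congr 1
  refine Finset.sum_congr rfl fun j _ => ?_
  rw [fourierCoef_div_sub_mul_comp_inv hR hF (hc₀ j) (hc₁ j)]
  have hn : 0 < ‖c j‖ := norm_pos_iff.2 (hc₀ j)
  split_ifs with hj
  · rw [fourierCoef_div_sub_mul hR hF (by rw [norm_inv]; exact inv_lt_one_of_one_lt₀ hj)]
    ring
  · rw [fourierCoef_div_sub_mul_of_one_lt hR hF (by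
      rw [norm_inv]
      exact (one_lt_inv₀ hn).2 (lt_of_le_of_ne (not_lt.1 hj) (hc₁ j)))]
    ring

end Disc

/-! ### Identification of E, the Szegő function and F -/

namespace LogParts

open Complex (exp)

variable {g k L : ℂ → ℂ} {R R₁ A : ℝ} {l : ℂ}

theorem fourierCoef_log_of_pos (h : LogParts g k R R₁ A)
    (hL : ∀ z ∈ sphere (0 : ℂ) 1, L z = l + g z + k z⁻¹) {n : ℤ} (hn : 0 < n) :
    fourierCoef L n = fourierCoef g n := by
  have hgc := continuousOn_unitSphere_of_disc h.one_lt' h.g_diff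
  have hkc := continuousOn_comp_inv (continuousOn_unitSphere_of_disc h.one_lt' h.k_diff)
  rw [fourierCoef_congr hL, fourierCoef_add (continuousOn_const.fun_add hgc) hkc,
    fourierCoef_add continuousOn_const hgc, fourierCoef_const hn.ne', fourierCoef_comp_inv,
    fourierCoef_of_neg h.one_lt' h.k_diff (by omega), zero_add, add_zero]

theorem fourierCoef_log_of_neg (h : LogParts g k R R₁ A)
    (hL : ∀ z ∈ sphere (0 : ℂ) 1, L z = l + g z + k z⁻¹) {n : ℤ} (hn : 0 < n) :
    fourierCoef L (-n) = fourierCoef k n := by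
  have hgc := continuousOn_unitSphere_of_disc h.one_lt' h.g_diff
  have hkc := continuousOn_comp_inv (continuousOn_unitSphere_of_disc h.one_lt' h.k_diff)
  rw [fourierCoef_congr hL, fourierCoef_add (continuousOn_const.fun_add hgc) hkc,
    fourierCoef_add continuousOn_const hgc, fourierCoef_const (by omega), fourierCoef_comp_inv,
    fourierCoef_of_neg h.one_lt' h.g_diff (by omega), zero_add, zero_add, neg_neg]

/-- Parseval for z g'(z) and k(1/z): the mean of their product is ∑ n g_n k_n, with g_n = L_n and
k_n = L_{-n} for n > 0. -/
theorem hasSum_termE (h : LogParts g k R R₁ A)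
    (hL : ∀ z ∈ sphere (0 : ℂ) 1, L z = l + g z + k z⁻¹) :
    HasSum (termE L) (szegoExponent g k) := by
  have hW : IsWiener fun z => z * deriv g z :=
    .of_annulus h.one_lt fun z _ h2 => differentiableAt_id.mul (h.differentiableAt_deriv_g h2)
  have hsub : sphere (0 : ℂ) 1 ⊆ ball 0 R₁ :=
    sphere_subset_closedBall.trans (closedBall_one_subset h.one_lt')
  have hcoef := fourierCoef_mul_deriv
    (fun z hz => h.g_diff.differentiableAt (isOpen_ball.mem_nhds (hsub hz))) hW.continuousOn
  have hkc := continuousOn_comp_inv (continuousOn_unitSphere_of_disc h.one_lt' h.k_diff)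
  have h1 := hW.hasSum_mul hkc 0
  rw [← Nat.cast_injective.hasSum_iff] at h1
  · refine (congrArg (HasSum · _) (funext fun n => ?_)).mpr h1
    simp only [Function.comp, hcoef, fourierCoef_comp_inv, zero_sub, neg_neg, termE]
    rcases n.eq_zero_or_pos with rfl | hn
    · simp
    · rw [h.fourierCoef_log_of_pos hL (by omega), h.fourierCoef_log_of_neg hL (by omega)]
      simp
  · intro n hn
    have : n < 0 := by
      by_contra h
      exact hn ⟨n.toNat, Int.toNat_of_nonneg (by omega)⟩
    rw [hcoef, fourierCoef_of_neg h.one_lt' h.g_diff this, mul_zero, zero_mul]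

theorem szegoFun_eq (h : LogParts g k R R₁ A)
    (hL : ∀ z ∈ sphere (0 : ℂ) 1, L z = l + g z + k z⁻¹) {z : ℂ} (hz : ‖z‖ ≠ 1) :
    szegoFun L z = exp (fourierCoef (fun τ => τ / (τ - z) * (l + g τ)) 0 +
      fourierCoef (fun τ => τ / (τ - z) * k τ⁻¹) 0) := by
  have hgc := continuousOn_unitSphere_of_disc h.one_lt' (h.g_diff.const_add l)
  have hkc := continuousOn_comp_inv (continuousOn_unitSphere_of_disc h.one_lt' h.k_diff)
  rw [← fourierCoef_add ((continuousOn_div_sub hz).fun_mul hgc) ((continuousOn_div_sub hz).fun_mul hkc),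
    szegoFun, fourierCoef]
  congr 2
  refine circleIntegral.integral_congr zero_le_one fun τ hτ => ?_
  have := ne_zero_of_mem_unitSphere hτ
  simp only [neg_zero, zpow_zero, one_mul, hL τ hτ]
  field_simp

theorem szegoFun_of_norm_lt_one (h : LogParts g k R R₁ A)
    (hL : ∀ z ∈ sphere (0 : ℂ) 1, L z = l + g z + k z⁻¹) {z : ℂ} (hz : ‖z‖ < 1) :
    szegoFun L z = exp (l + g z) := by
  rw [h.szegoFun_eq hL hz.ne, fourierCoef_div_sub_mul h.one_lt' (h.g_diff.const_add l) hz]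
  suffices fourierCoef (fun τ => τ / (τ - z) * k τ⁻¹) 0 = 0 by rw [this, add_zero]
  rcases eq_or_ne z 0 with rfl | hz0
  · have h1 : fourierCoef (fun τ => τ / (τ - 0) * k τ⁻¹) 0 = fourierCoef (fun τ => k τ⁻¹) 0 :=
      fourierCoef_congr (fun τ hτ => by
        simp only [sub_zero, div_self (ne_zero_of_mem_unitSphere hτ), one_mul]) 0
    rw [h1, fourierCoef_comp_inv, neg_zero, fourierCoef_zero_of_disc h.one_lt' h.k_diff, h.k_zero]
  · rw [fourierCoef_div_sub_mul_comp_inv h.one_lt' h.k_diff hz0 hz.ne, h.k_zero,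
      fourierCoef_div_sub_mul_of_one_lt h.one_lt' h.k_diff, sub_zero]
    rw [norm_inv]
    exact (one_lt_inv₀ (norm_pos_iff.2 hz0)).2 hz

theorem szegoFun_of_one_lt_norm (h : LogParts g k R R₁ A)
    (hL : ∀ z ∈ sphere (0 : ℂ) 1, L z = l + g z + k z⁻¹) {z : ℂ} (hz : 1 < ‖z‖) :
    szegoFun L z = exp (-k z⁻¹) := by
  have hz0 : z ≠ 0 := norm_pos_iff.1 (one_pos.trans hz)
  rw [h.szegoFun_eq hL hz.ne', fourierCoef_div_sub_mul_of_one_lt h.one_lt' (h.g_diff.const_add l)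
    hz, fourierCoef_div_sub_mul_comp_inv h.one_lt' h.k_diff hz0 hz.ne', h.k_zero,
    fourierCoef_div_sub_mul h.one_lt' h.k_diff (by
      rw [norm_inv]
      exact inv_lt_one_of_one_lt₀ hz), zero_add, zero_sub]

/-- The symbol `ψ/(G φ₋)` of the bordering column. -/
noncomputable def borderSymbol (g k : ℂ → ℂ) (l : ℂ) (q₁ q₂ : ℂ → ℂ) (z : ℂ) : ℂ :=
  q₁ z * exp (g z) + exp (-l) * (q₂ z * exp (-k z⁻¹))

theorem fourierCoef_borderSymbol (h : LogParts g k R R₁ A)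
    (hL : ∀ z ∈ sphere (0 : ℂ) 1, L z = l + g z + k z⁻¹) {m : ℕ} (a₀ a₁ b₀ ah₀ ah₁ bh₀ : ℂ)
    (b bh : Fin m → ℂ) {c : Fin m → ℂ} (hc₀ : ∀ j, c j ≠ 0) (hc₁ : ∀ j, ‖c j‖ ≠ 1)
    (hd₁ : ContinuousOn (ratq₁ a₀ a₁ b₀ b c) (sphere 0 1))
    (hd₂ : ContinuousOn (ratq₂ ah₀ ah₁ bh₀ bh c) (sphere 0 1)) :
    fourierCoef (borderSymbol g k l (ratq₁ a₀ a₁ b₀ b c) (ratq₂ ah₀ ah₁ bh₀ bh c)) 0 =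
      constF L a₀ b₀ ah₀ ah₁ b bh c := by
  have hF₁ : DifferentiableOn ℂ (fun z => exp (g z)) (ball 0 R₁) := h.g_diff.cexp
  have hF₂ : DifferentiableOn ℂ (fun z => exp (-k z)) (ball 0 R₁) := h.k_diff.neg.cexp
  have hmem : ball (0 : ℂ) R₁ ∈ nhds 0 := ball_mem_nhds 0 (one_pos.trans h.one_lt')
  have hdF₁ : deriv (fun z => exp (g z)) 0 = fourierCoef L 1 := by
    rw [h.fourierCoef_log_of_pos hL one_pos, fourierCoef_one_of_disc h.one_lt' h.g_diff,
      (h.g_diff.differentiableAt hmem).hasDerivAt.cexp.deriv, h.g_zero, Complex.exp_zero, one_mul]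
  have hdF₂ : deriv (fun z => exp (-k z)) 0 = -fourierCoef L (-1) := by
    rw [h.fourierCoef_log_of_neg hL one_pos, fourierCoef_one_of_disc h.one_lt' h.k_diff,
      ((h.k_diff.differentiableAt hmem).hasDerivAt.fun_neg.cexp).deriv]
    simp [h.k_zero]
  have h0 : szegoFun L 0 = exp l := by
    rw [h.szegoFun_of_norm_lt_one hL (by simp), h.g_zero, add_zero]
  change fourierCoef (fun z => ratq₁ a₀ a₁ b₀ b c z * exp (g z) +
    exp (-l) * (ratq₂ ah₀ ah₁ bh₀ bh c z * exp (-k z⁻¹))) 0 = _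
  rw [fourierCoef_add (f := fun z => ratq₁ a₀ a₁ b₀ b c z * exp (g z))
      (hd₁.fun_mul (continuousOn_unitSphere_of_disc h.one_lt' hF₁))
      (continuousOn_const.fun_mul (hd₂.fun_mul
        (continuousOn_comp_inv (continuousOn_unitSphere_of_disc h.one_lt' hF₂)))),
    fourierCoef_const_mul, fourierCoef_ratq₁_mul h.one_lt' hF₁ _ _ _ _ hc₁,
    fourierCoef_ratq₂_mul h.one_lt' hF₂ _ _ _ _ hc₀ hc₁, hdF₁, hdF₂, constF, h0, Finset.sum_filter,
    Finset.sum_filter, h.g_zero, h.k_zero, neg_zero, Complex.exp_zero, mul_one, mul_one, one_div,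
    ← Complex.exp_neg, mul_neg, ← sub_eq_add_neg]
  -- Inside the disc α(c)/α(0) = e^{g(c)}; outside, α(c) = e^{-k(1/c)}.
  have hs₁ : (∑ j, if ‖c j‖ < 1 then b j * exp (g (c j)) else 0) =
      ∑ j, if 0 < ‖c j‖ ∧ ‖c j‖ < 1 then b j * (szegoFun L (c j) / exp l) else 0 := by
    refine Finset.sum_congr rfl fun j _ => ?_
    have hj0 : 0 < ‖c j‖ := norm_pos_iff.2 (hc₀ j)
    refine ite_congr (by simp [hj0]) (fun hj => ?_) fun _ => rfl
    rw [h.szegoFun_of_norm_lt_one hL hj.2, ← Complex.exp_sub, add_sub_cancel_left]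
  have hs₂ : (∑ j, if 1 < ‖c j‖ then bh j / c j * exp (-k (c j)⁻¹) else 0) =
      ∑ j, if 1 < ‖c j‖ then bh j / c j * szegoFun L (c j) else 0 := by
    refine Finset.sum_congr rfl fun j _ => ite_congr rfl (fun hj => ?_) fun _ => rfl
    rw [h.szegoFun_of_one_lt_norm hL hj]
  rw [hs₁, hs₂]

end LogParts

/-! ### The bordered determinant and the main theorem -/

/-- Reversing both rows and columns keeps the determinant, turns φ_{k-j} into φ_{j-k}, and moves the
last column to the front with entries ψ_j. -/
theorem borderedDet_eq_cramer {φ ψ : ℂ → ℂ} {u v : ℤ → ℂ} {a : ℂ}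
    (hφ : ∀ n, fourierCoef φ n = a * u n) (hψ : ∀ n, fourierCoef ψ n = a * v n) {N : ℕ}
    (hN : 0 < N) :
    borderedDet φ ψ N = a ^ N * (toep u N).cramer (fun j => v (j : ℕ)) ⟨0, hN⟩ := by
  have h1 : ∀ B : Matrix (Fin N) (Fin N) ℂ, a ^ N * B.det = (a • B).det := fun B => by
    rw [Matrix.det_smul, Fintype.card_fin]
  rw [Matrix.cramer_apply, h1, borderedDet, ← Matrix.det_submatrix_equiv_self Fin.revPerm]
  congr 1
  ext j k
  simp only [Matrix.submatrix_apply, Matrix.of_apply, Fin.revPerm_apply, Fin.val_rev,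
    Matrix.smul_apply, smul_eq_mul]
  have hj := j.2
  have hk := k.2
  rcases eq_or_ne k ⟨0, hN⟩ with rfl | hk0
  · rw [if_pos (by simp only; omega), Matrix.updateCol_self, hψ]
    congr 2
    omega
  · have hk1 : (k : ℕ) ≠ 0 := fun h => hk0 (Fin.ext h)
    rw [if_neg (by omega), Matrix.updateCol_ne hk0, hφ, toep_apply]
    congr 2
    omega

end BorderedToeplitz

open BorderedToeplitz in
theorem theorem1p1 (φ : ℂ → ℂ) (hφ : IsSzegoType φ)
    (m : ℕ) (a₀ a₁ b₀ ah₀ ah₁ bh₀ : ℂ) (b bh c : Fin m → ℂ)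
    (hc₀ : ∀ j, c j ≠ 0) (hc₁ : ∀ j, ‖c j‖ ≠ 1)
    (ψ : ℂ → ℂ)
    (hψ : ∀ z ∈ Metric.sphere (0 : ℂ) 1,
      ψ z = ratq₁ a₀ a₁ b₀ b c z * φ z + ratq₂ ah₀ ah₁ bh₀ bh c z) :
    (∃ L, IsContinuousLog φ L) ∧
    (∀ L, IsContinuousLog φ L → Summable (termE L)) ∧
    ∃ κ : ℝ, 0 < κ ∧ ∀ L, IsContinuousLog φ L →
      ∃ r : ℕ → ℂ, r =O[atTop] (fun N : ℕ => Real.exp (-κ * N)) ∧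
        ∀ N : ℕ, 1 < N →
          borderedDet φ ψ N =
            constG L ^ N * constE L * (constF L a₀ b₀ ah₀ ah₁ b bh c + r N) := by
  obtain ⟨f, hf, hfφ⟩ := hφ.continuation
  have hf0 : ∀ z ∈ sphere (0 : ℂ) 1, f z ≠ 0 := fun z hz => hfφ hz ▸ hφ.ne_zero z hz
  -- The closed annulus avoids the zeros of the continuation and all c_j, so z f'/f and the rational
  -- functions are analytic there.
  obtain ⟨R₁, hR₁, hU⟩ : ∃ R : ℝ, 1 < R ∧ ∀ z : ℂ, R⁻¹ ≤ ‖z‖ → ‖z‖ ≤ R →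
      (AnalyticAt ℂ f z ∧ f z ≠ 0) ∧ z ∈ (Set.range c)ᶜ := by
    refine exists_annulus_subset (U := {z | (AnalyticAt ℂ f z ∧ f z ≠ 0) ∧ z ∈ (Set.range c)ᶜ})
      (IsOpen.inter ?_ (Set.finite_range c).isClosed.isOpen_compl)
      fun z hz => ⟨⟨hf z hz, hf0 z hz⟩, ?_⟩
    · exact isOpen_iff_mem_nhds.2 fun z hz =>
        hz.1.eventually_analyticAt.and (hz.1.continuousAt.eventually_ne hz.2)
    · rintro ⟨j, rfl⟩
      exact hc₁ j (mem_sphere_zero_iff_norm.1 hz)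
  obtain ⟨R, hR, hRR₁⟩ := exists_between hR₁
  have hann : ∀ z : ℂ, R⁻¹ ≤ ‖z‖ → ‖z‖ ≤ R → z ≠ 0 ∧ ∀ j, z - c j ≠ 0 := fun z h1 h2 =>
    ⟨norm_pos_iff.1 ((inv_pos.2 (one_pos.trans hR)).trans_le h1), fun j hj =>
      (hU z ((inv_anti₀ (one_pos.trans hR) hRR₁.le).trans h1) (h2.trans hRR₁.le)).2
        ⟨j, (sub_eq_zero.1 hj).symm⟩⟩
  have hq₁ : ∀ z : ℂ, R⁻¹ ≤ ‖z‖ → ‖z‖ ≤ R → DifferentiableAt ℂ (ratq₁ a₀ a₁ b₀ b c) z :=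
    fun z h1 h2 => by
      obtain ⟨hz, hzc⟩ := hann z h1 h2
      unfold ratq₁
      fun_prop (disch := first | exact hz | exact hzc _)
  have hq₂ : ∀ z : ℂ, R⁻¹ ≤ ‖z‖ → ‖z‖ ≤ R → DifferentiableAt ℂ (ratq₂ ah₀ ah₁ bh₀ bh c) z :=
    fun z h1 h2 => by
      obtain ⟨hz, hzc⟩ := hann z h1 h2
      unfold ratq₂
      fun_prop (disch := first | exact hz | exact hzc _)
  have hparts : ∀ L, IsContinuousLog φ L → ∃ g k A, LogParts g k R R₁ A ∧
      ∀ z ∈ sphere (0 : ℂ) 1, L z = fourierCoef L 0 + g z + k z⁻¹ := fun L hL => by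
    obtain ⟨C, -, hC⟩ := hL.exists_decay hf hfφ hR₁ fun z h1 h2 => (hU z h1 h2).1
    exact exists_logParts hL.1 hR hRR₁ hC
  -- The rate is fixed before any logarithm is chosen; with κ = -log ρ the error scale exp(-κN) is
  -- ρ^N.
  obtain ⟨ρ, hρ, hρ1⟩ := exists_between (inv_lt_one_of_one_lt₀ hR)
  have hρ0 : 0 < ρ := (inv_pos.2 (one_pos.trans hR)).trans hρ
  refine ⟨exists_isContinuousLog hφ, fun L hL => ?_, -Real.log ρ, neg_pos.2
    (Real.log_neg hρ0 hρ1), fun L hL => ?_⟩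
  · obtain ⟨g, k, A, h, hLz⟩ := hparts L hL
    exact (h.hasSum_termE hLz).summable
  obtain ⟨g, k, A, h, hLz⟩ := hparts L hL
  set χ := LogParts.borderSymbol g k (fourierCoef L 0) (ratq₁ a₀ a₁ b₀ b c)
    (ratq₂ ah₀ ah₁ bh₀ bh c) with hχ
  have hχd : ∀ z : ℂ, R⁻¹ ≤ ‖z‖ → ‖z‖ ≤ R → DifferentiableAt ℂ χ z := fun z h1 h2 =>
    ((hq₁ z h1 h2).mul (h.differentiableAt_g h2).cexp).add
      (((hq₂ z h1 h2).mul (h.differentiableAt_k_inv h1).neg.cexp).const_mul _)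
  obtain ⟨K, hK0, hK⟩ := h.exists_norm_cramer_sub_le hρ hχd
  rw [h.fourierCoef_borderSymbol hLz _ _ _ _ _ _ _ _ hc₀ hc₁
    (continuousOn_unitSphere_of_annulus hR hq₁) (continuousOn_unitSphere_of_annulus hR hq₂)] at hK
  have hE : constE L = Complex.exp (LogParts.szegoExponent g k) := by
    rw [constE, (h.hasSum_termE hLz).tsum_eq]
  have hφc : ∀ z ∈ sphere (0 : ℂ) 1,
      φ z = constG L * (Complex.exp (g z) * Complex.exp (k z⁻¹)) := fun z hz => by
    rw [← hL.2 z hz, hLz z hz, Complex.exp_add, Complex.exp_add, constG, mul_assoc]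
  have hφn : ∀ n, fourierCoef φ n =
      constG L * fourierCoef (fun z => Complex.exp (g z) * Complex.exp (k z⁻¹)) n := fun n => by
    rw [← fourierCoef_const_mul]
    exact fourierCoef_congr hφc n
  have hψn : ∀ n, fourierCoef ψ n =
      constG L * fourierCoef (fun z => Complex.exp (k z⁻¹) * χ z) n := fun n => by
    rw [← fourierCoef_const_mul]
    refine fourierCoef_congr (fun z hz => ?_) n
    have h1 : constG L * Complex.exp (-fourierCoef L 0) = 1 := by
      rw [constG, ← Complex.exp_add, add_neg_cancel, Complex.exp_zero]
    have h2 : Complex.exp (k z⁻¹) * Complex.exp (-k z⁻¹) = 1 := by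
      rw [← Complex.exp_add, add_neg_cancel, Complex.exp_zero]
    simp only [hψ z hz, hφc z hz, hχ, LogParts.borderSymbol]
    linear_combination -ratq₂ ah₀ ah₁ bh₀ bh c z * h2 -
      Complex.exp (k z⁻¹) * Complex.exp (-k z⁻¹) * ratq₂ ah₀ ah₁ bh₀ bh c z * h1
  have hG0 : constG L ≠ 0 := Complex.exp_ne_zero _
  have hE0 : constE L ≠ 0 := Complex.exp_ne_zero _
  -- The remainder is defined by solving the claimed identity for it, which is possible since G and
  -- E are exponentials; only its size needs proof.
  refine ⟨fun N => borderedDet φ ψ N / (constG L ^ N * constE L) -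
    constF L a₀ b₀ ah₀ ah₁ b bh c, ?_, fun N _ => ?_⟩
  · refine IsBigO.of_bound (‖constE L‖⁻¹ * K) ?_
    filter_upwards [eventually_gt_atTop 0] with N hN
    have h1 := hK N hN
    rw [borderedDet_eq_cramer hφn hψn hN, mul_div_mul_left _ _ (pow_ne_zero N hG0),
      ← hE] at *
    rw [Real.norm_of_nonneg (Real.exp_pos _).le, neg_neg, mul_comm (Real.log ρ), Real.exp_nat_mul,
      Real.exp_log hρ0, div_sub' hE0, norm_div, div_eq_inv_mul, mul_assoc]
    gcongr
  · rw [add_sub_cancel, mul_div_cancel₀]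
    exact mul_ne_zero (pow_ne_zero N hG0) hE0
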